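/- All sets are in $\mathbb{R}^2$. Let $\Omega\subset\mathbb{R}^2$ be a Lipschitz domain, and let $V_{\rm ang}\subset\partial\Omega$ be the set of its angular points, i.e. the points of $\partial\Omega$ where the outward normal is discontinuous. A regular polytope is a set $E\setminus\bigcup_{i=1}^N \overline{I_i}$, where $E,I_1,\dots,I_N$ are bounded open sets with boundary a finite union of segments, each homeomorphic up to the boundary to the unit disc, and the $\overline{I_i}\subset E$ are pairwise disjoint; its vertices are the boundary points where two non-parallel edges meet. For $i=1,2$ let $\Omega_{{\rm p},i}$ be a regular polytope with vertex set $V_i$, and $\Psi_i:\overline{\Omega}_{{\rm p},i}\to\overline{\Omega}$ a map, such that (i) $V_i\subset\partial\Omega$; (ii) $V_{\rm ang}\subset V_i$; (iii) every straight segment contained in $\partial\Omega$ is contained in $\partial\Omega_{{\rm p},i}$; (iv) $\Psi_i$ is a Lipschitz bijection from $\overline{\Omega}_{{\rm p},i}$ to $\overline{\Omega}$ which maps $\Omega_{{\rm p},i}$ onto $\Omega$, $\Psi_i(v)=v$ for all $v\in V_i$, and $\det\nabla\Psi_i>0$ a.e. in $\Omega_{{\rm p},i}$. Let $V_i^{\rm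 fict}=V_i\setminus V_{\rm ang}$. For $x,y\in\partial\Omega$ let ${\rm dist}_{\partial\Omega}(x,y)\in[0,+\infty]$ be the infimum of the lengths $\int_0^1\|\dot\gamma\|_2\,dt$ over all $\gamma\in C^1([0,1];\partial\Omega)$ with $\gamma(0)=x$, $\gamma(1)=y$ and $\|\dot\gamma\|_2$ constant ($+\infty$ if there is no such curve), and set $$ C=\min\Big\{\min_{x\in V_1^{\rm fict},\,y\in V_2^{\rm fict}}{\rm dist}_{\partial\Omega}(x,y),\ \min_{x,y\in V_1,\,x\ne y}{\rm dist}_{\partial\Omega}(x,y),\ \min_{x,y\in V_2,\,x\neq y}{\rm dist}_{\partial\Omega}(x,y)\Big\}, $$ where a minimum over an empty set is $+\infty$. Let $\Phi$ be a $C^1$ diffeomorphism of $\Omega$ (a bijection of $\overline\Omega$ onto itself which maps $\Omega$ onto $\Omega$ and is, together with its inverse, of class $C^1$ up to the boundary) with $\det\nabla\Phi>0$ in $\Omega$ and ${\rm dist}_{\partial\Omega}(x,\Phi(x))<C$ for every $x\in\partial\Omega$. Then there exist maps $\Phi_i={\tt id}+\varphi_i$, $i=1,2$, which are homeomorphisms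 of $\overline{\Omega}_{{\rm p},i}$ onto itself mapping $\Omega_{{\rm p},i}$ onto itself, such that $$ \Phi=\Psi_1\circ\Phi_1\circ\Psi_1^{-1}\circ\Psi_2\circ\Phi_2\circ\Psi_2^{-1}\quad\text{on }\overline\Omega, \qquad \varphi_i\cdot\mathbf n=0\ \text{ on }\partial\Omega_{{\rm p},i},\quad i=1,2 $$ (at every boundary point where the normal $\mathbf n$ exists), and such that, for $i=1,2$, $\varphi_i$ is Lipschitz whenever $\Psi_i^{-1}$ is Lipschitz. -/

import Mathlib

open MeasureTheory Set Filter Topology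
open scoped ENNReal NNReal

/-- The Euclidean plane. -/
abbrev Plane : Type := EuclideanSpace ℝ (Fin 2)

/-- `ν` is the outward unit normal to `ω` at `x`: up to `o(‖y - x‖)`, the set `ω` lies on the
negative side of the line through `x` orthogonal to `ν`, and its exterior on the positive side.
For a Lipschitz domain such a `ν` is unique, and it exists exactly where the boundary has a
tangent line (for a polygon: everywhere except at the vertices). -/
def IsOutwardNormal (ω : Set Plane) (x ν : Plane) : Prop :=
  ‖ν‖ = 1 ∧ ∀ ε > 0, ∀ᶠ y in 𝓝 x,
    (y ∈ ω → inner ℝ (y - x) ν ≤ ε * ‖y - x‖) ∧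
    (y ∉ closure ω → -(ε * ‖y - x‖) ≤ inner ℝ (y - x) ν)

/-- A Lipschitz domain of the plane: a nonempty, open, connected set which, near each of its
boundary points and in suitable orthonormal coordinates, is the region strictly above the graph
of a Lipschitz function. -/
structure IsLipschitzDomain (Ω : Set Plane) : Prop where
  isOpen : IsOpen Ω
  isConnected : IsConnected Ω
  locally_epigraph : ∀ x ∈ frontier Ω, ∃ e₁ e₂ : Plane, ‖e₁‖ = 1 ∧ ‖e₂‖ = 1 ∧
    inner ℝ e₁ e₂ = 0 ∧ ∃ r > 0, ∃ (K : ℝ≥0) (f : ℝ → ℝ), LipschitzWith K f ∧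
      ∀ y ∈ Metric.ball x r, y ∈ Ω ↔ f (inner ℝ (y - x) e₁) < inner ℝ (y - x) e₂

/-- The angular points of `Ω`: the boundary points at which the outward normal is discontinuous,
that is, near which there is no continuous outward normal field on the boundary. -/
def angularPoints (Ω : Set Plane) : Set Plane :=
  {x | x ∈ frontier Ω ∧ ¬ ∃ (n : Plane → Plane), ∃ U ∈ 𝓝 x,
    ContinuousOn n (frontier Ω ∩ U) ∧ ∀ y ∈ frontier Ω ∩ U, IsOutwardNormal Ω y (n y)}

/-- A bounded (open) polytope of the plane: its boundary is a finite union of segments. -/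
structure IsBoundedPolytope (P : Set Plane) : Prop where
  isOpen : IsOpen P
  isBounded : Bornology.IsBounded P
  frontier_eq : ∃ S : Finset (Plane × Plane), frontier P = ⋃ s ∈ S, segment ℝ s.1 s.2

/-- `D` is isomorphic, up to the boundary, to the unit ball of the plane. -/
def IsIsomorphicToUnitBall (D : Set Plane) : Prop :=
  ∃ h : closure D ≃ₜ Metric.closedBall (0 : Plane) 1,
    ∀ x : closure D, (x : Plane) ∈ D ↔ (h x : Plane) ∈ Metric.ball (0 : Plane) 1

/-- A regular bounded polytope: a polytope isomorphic to the unit ball, from which finitely many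
disjoint closed polytopes isomorphic to the unit ball and compactly embedded in it are removed. -/
def IsRegularPolytope (P : Set Plane) : Prop :=
  IsBoundedPolytope P ∧ ∃ (E : Set Plane) (N : ℕ) (I : Fin N → Set Plane),
    IsBoundedPolytope E ∧ IsIsomorphicToUnitBall E ∧
    (∀ i, IsBoundedPolytope (I i) ∧ IsIsomorphicToUnitBall (I i) ∧ closure (I i) ⊆ E) ∧
    (∀ i j, i ≠ j → Disjoint (closure (I i)) (closure (I j))) ∧
    P = E \ ⋃ i, closure (I i)

/-- The vertices of a polytope: the boundary points at which two non-parallel edges meet. -/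
def polytopeVertices (P : Set Plane) : Set Plane :=
  {x | ∃ u v : Plane, LinearIndependent ℝ ![u, v] ∧
    segment ℝ x (x + u) ⊆ frontier P ∧ segment ℝ x (x + v) ⊆ frontier P}

/-- The fictitious vertices of `P`: the vertices that are not angular points of `Ω`. -/
def fictitiousVertices (Ω P : Set Plane) : Set Plane :=
  polytopeVertices P \ angularPoints Ω

/-- The compatibility conditions between a domain `Ω`, a regular polytope `P` and a map `Ψ` from
`P` to `Ω`. The map `Ψ` is considered together with its values on the closure of `P`. -/
structure IsPolytopalModel (Ω P : Set Plane) (Ψ : Plane → Plane) : Prop where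
  regular : IsRegularPolytope P
  vertices_subset : polytopeVertices P ⊆ frontier Ω
  angular_subset : angularPoints Ω ⊆ polytopeVertices P
  linear_facets : ∀ a b : Plane, a ≠ b → segment ℝ a b ⊆ frontier Ω → segment ℝ a b ⊆ frontier P
  lipschitz : ∃ K : ℝ≥0, LipschitzOnWith K Ψ (closure P)
  bijOn : BijOn Ψ P Ω
  bijOn_closure : BijOn Ψ (closure P) (closure Ω)
  eq_on_vertices : ∀ x ∈ polytopeVertices P, Ψ x = x
  jacobian_pos : ∀ᵐ x ∂(volume.restrict P), 0 < (fderiv ℝ Ψ x).det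

/-- The inverse, from `closure Ω` to `closure P`, of a bijection `Ψ` from `closure P` to
`closure Ω`. -/
noncomputable def modelInverse (P : Set Plane) (Ψ : Plane → Plane) : Plane → Plane :=
  Function.invFunOn Ψ (closure P)

/-- `C¹` curves, of constant speed, in the boundary of `Ω` from `x` to `y`. -/
def boundaryCurves (Ω : Set Plane) (x y : Plane) : Set (ℝ → Plane) :=
  {γ | ContDiffOn ℝ 1 γ (Icc 0 1) ∧ (∀ t ∈ Icc (0 : ℝ) 1, γ t ∈ frontier Ω) ∧
    γ 0 = x ∧ γ 1 = y ∧ ∃ c : ℝ, ∀ t ∈ Icc (0 : ℝ) 1, ‖derivWithin γ (Icc 0 1) t‖ = c}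

/-- The geodesic distance in the boundary of `Ω`: the infimum of the lengths of the curves in
`boundaryCurves Ω x y`, and `∞` if there is no such curve. -/
noncomputable def boundaryDist (Ω : Set Plane) (x y : Plane) : ℝ≥0∞ :=
  ⨅ γ ∈ boundaryCurves Ω x y, ENNReal.ofReal (∫ t in (0 : ℝ)..1, ‖derivWithin γ (Icc 0 1) t‖)

/-- The smallest boundary distance between two distinct vertices of `P`. -/
noncomputable def vertexSeparation (Ω P : Set Plane) : ℝ≥0∞ :=
  ⨅ x ∈ polytopeVertices P, ⨅ y ∈ polytopeVertices P, ⨅ _ : x ≠ y, boundaryDist Ω x y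

/-- The constant `C(P₁, P₂)`; a minimum over an empty set is `∞`. -/
noncomputable def deformationBound (Ω P₁ P₂ : Set Plane) : ℝ≥0∞ :=
  min (⨅ x ∈ fictitiousVertices Ω P₁, ⨅ y ∈ fictitiousVertices Ω P₂, boundaryDist Ω x y)
    (min (vertexSeparation Ω P₁) (vertexSeparation Ω P₂))

/-- `Φ` is a diffeomorphism of `Ω`, of class `C¹` up to the boundary together with its inverse. -/
structure IsDomainDiffeo (Ω : Set Plane) (Φ : Plane → Plane) : Prop where
  bijOn : BijOn Φ Ω Ω
  bijOn_closure : BijOn Φ (closure Ω) (closure Ω)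
  contDiffOn : ContDiffOn ℝ 1 Φ (closure Ω)
  contDiffOn_inverse : ∃ Θ : Plane → Plane, ContDiffOn ℝ 1 Θ (closure Ω) ∧
    InvOn Θ Φ (closure Ω) (closure Ω)

/-- `id + φ` is a homeomorphism of `P` up to the boundary (its inverse is continuous because
`closure P` is compact) and the normal component of `φ` vanishes on the boundary of `P`. -/
structure IsTangentialDisplacement (P : Set Plane) (φ : Plane → Plane) : Prop where
  continuousOn : ContinuousOn φ (closure P)
  bijOn : BijOn (fun x => x + φ x) P P
  bijOn_closure : BijOn (fun x => x + φ x) (closure P) (closure P)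
  normal_eq_zero : ∀ x ∈ frontier P, ∀ ν : Plane, IsOutwardNormal P x ν → inner ℝ (φ x) ν = 0

/-! ### Orthonormal frames of the plane -/

/-! Write Θ for the inverse of Φ. Everything reduces to one bi-Lipschitz bijection B of the plane
which preserves Ω, fixes the vertices of P₂ and sends Θ v to v for every vertex v of P₁
(`exists_fixingMaps_vertices`). Then Φ = (Φ ∘ B⁻¹) ∘ B, where the first factor fixes the vertices of
P₁ and the second those of P₂. Conjugating the factors by Ψ₁ and Ψ₂ gives Φ₁ and Φ₂, and the
composition telescopes. A boundary homeomorphism that fixes all vertices maps each open edge into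
itself, so the displacement is parallel to the edge and has no normal component (`mapsTo_edge`,
`isTangentialDisplacement`). The Lipschitz claim holds because Φ, being C¹ up to the boundary of a
bounded Lipschitz domain, is Lipschitz on its closure.

To build B, straighten the boundary locally and push a boundary point sideways by a compactly
supported shear. Connectedness then moves p to q inside any connected part K of the boundary, fixing
a closed set disjoint from K (`exists_fixingMaps`). So each fictitious vertex v of P₁ needs such a K
joining Θ v to v and avoiding the vertices of P₂, the other vertices of P₁ and their preimages
(`exists_isPreconnected_to_vertex`). Angular points need no motion: Φ carries normals to normals, so
Θ maps angular points to angular points, and the bound C leaves them no room to move.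

The set K is found on P₁. The bound C yields a connected set T joining Θ v to v that contains no
vertex of P₁ but v and no vertex of P₂. Hence the pull-back of Θ v is v itself or lies on an edge
issuing from v, and K is the image of the segment between them. Were the preimage of another vertex
on this segment, that vertex would be the far end of the edge, and the preimages of the two ends
would occur in reversed order; `not_crossing` excludes this by injectivity and the intermediate
value theorem. -/

theorem eq_sum_of_orthonormal_frame {e₁ e₂ : Plane} (h1 : ‖e₁‖ = 1) (h2 : ‖e₂‖ = 1)
    (h12 : inner ℝ e₁ e₂ = 0) (z : Plane) :
    z = (inner ℝ z e₁ : ℝ) • e₁ + (inner ℝ z e₂ : ℝ) • e₂ := by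
  have ho : Orthonormal ℝ ![e₁, e₂] := by
    constructor
    · intro i; fin_cases i <;> simp [h1, h2]
    · intro i j hij
      fin_cases i <;> fin_cases j <;> simp_all [real_inner_comm]
  have hspan : ⊤ ≤ Submodule.span ℝ (range ![e₁, e₂]) :=
    (ho.linearIndependent.span_eq_top_of_card_eq_finrank (by simp)).ge
  have hsum := (OrthonormalBasis.mk ho hspan).sum_repr z
  simp only [OrthonormalBasis.repr_apply_apply, OrthonormalBasis.coe_mk, Fin.sum_univ_two,
    Matrix.cons_val_zero, Matrix.cons_val_one] at hsum
  rw [real_inner_comm e₁ z, real_inner_comm e₂ z]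
  exact hsum.symm

theorem inner_frame_combination {e₁ e₂ : Plane} (h1 : ‖e₁‖ = 1) (h2 : ‖e₂‖ = 1)
    (h12 : inner ℝ e₁ e₂ = 0) (a b : ℝ) :
    inner ℝ (a • e₁ + b • e₂) e₁ = a ∧ inner ℝ (a • e₁ + b • e₂) e₂ = b := by
  simp [inner_add_left, inner_smul_left, h1, h2, h12, real_inner_comm]

theorem abs_inner_le_norm_of_unit {e : Plane} (h : ‖e‖ = 1) (z : Plane) :
    |inner ℝ z e| ≤ ‖z‖ := by
  simpa [h] using abs_real_inner_le_norm z e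

/-! ### Local structure of a Lipschitz domain -/

namespace IsLipschitzDomain

variable {Ω : Set Plane}

/-- A graph chart at a boundary point, normalized at that point. -/
theorem exists_graph (hΩ : IsLipschitzDomain Ω) {q : Plane} (hq : q ∈ frontier Ω) :
    ∃ e₁ e₂ : Plane, ‖e₁‖ = 1 ∧ ‖e₂‖ = 1 ∧ inner ℝ e₁ e₂ = 0 ∧ ∃ r > 0, ∃ (K : ℝ≥0) (f : ℝ → ℝ),
      LipschitzWith K f ∧ f 0 = 0 ∧
      (∀ y ∈ Metric.ball q r, y ∈ Ω ↔ f (inner ℝ (y - q) e₁) < inner ℝ (y - q) e₂) ∧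
      (∀ y ∈ Metric.ball q r, inner ℝ (y - q) e₂ < f (inner ℝ (y - q) e₁) → y ∉ closure Ω) := by
  obtain ⟨e₁, e₂, h1, h2, h12, r, hr, K, f, hf, h⟩ := hΩ.locally_epigraph q hq
  have hext : ∀ y ∈ Metric.ball q r, inner ℝ (y - q) e₂ < f (inner ℝ (y - q) e₁) →
      y ∉ closure Ω := by
    intro y hy hlt hcl
    have hev : ∀ᶠ z in 𝓝 y, z ∉ Ω := by
      have c1 : Continuous fun z : Plane => (inner ℝ (z - q) e₂ : ℝ) := by fun_prop
      have c2 : Continuous fun z : Plane => f (inner ℝ (z - q) e₁ : ℝ) :=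
        hf.continuous.comp (by fun_prop)
      filter_upwards [Metric.isOpen_ball.mem_nhds hy,
        c1.continuousAt.eventually_lt c2.continuousAt hlt] with z hz hz'
      rw [h z hz]; exact not_lt.2 hz'.le
    exact (mem_closure_iff_frequently.1 hcl) hev
  have hq' : q ∈ Metric.ball q r := Metric.mem_ball_self hr
  rw [hΩ.isOpen.frontier_eq] at hq
  have hf0 : f 0 = 0 := by
    have ha := h q hq'
    have hb := hext q hq'
    simp only [sub_self, inner_zero_left] at ha hb
    refine le_antisymm ?_ ?_
    · by_contra hc
      exact hb (not_le.1 hc) hq.1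
    · by_contra hc
      exact hq.2 (ha.2 (not_le.1 hc))
  exact ⟨e₁, e₂, h1, h2, h12, r, hr, K, f, hf, hf0, h, hext⟩

/-- The uniform interior and exterior cone properties. -/
theorem exists_cone (hΩ : IsLipschitzDomain Ω) {q : Plane} (hq : q ∈ frontier Ω) :
    ∃ e : Plane, ‖e‖ = 1 ∧ ∃ κ > 0, κ ≤ 1 ∧ ∃ r > 0,
      (∀ x ∈ closure Ω, x ∈ Metric.ball q r → ∀ w : Plane, ‖w‖ ≤ κ → ∀ t ∈ Ioo 0 r,
        x + t • (e + w) ∈ Ω) ∧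
      (∀ x, x ∉ Ω → x ∈ Metric.ball q r → ∀ w : Plane, ‖w‖ ≤ κ → ∀ t ∈ Ioo 0 r,
        x - t • (e + w) ∉ closure Ω) := by
  obtain ⟨e₁, e₂, h1, h2, h12, R, hR, K, f, hf, -, h, hext⟩ := hΩ.exists_graph hq
  have hK : (0 : ℝ) ≤ K := K.2
  have h21 : inner ℝ e₂ e₁ = (0 : ℝ) := by rw [real_inner_comm]; exact h12
  -- The aperture 1 / (K + 2) gives (K + 1)‖w‖ < 1, so every direction e₂ + w is steeper than the
  -- slope K of the graph.
  have key : ∀ w : Plane, ‖w‖ ≤ 1 / (K + 2 : ℝ) → ∀ t : ℝ, 0 < t →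
      K * |inner ℝ (t • (e₂ + w)) e₁| < inner ℝ (t • (e₂ + w)) e₂ := by
    intro w hw t ht
    have a1 := abs_inner_le_norm_of_unit h1 w
    have a2 := abs_inner_le_norm_of_unit h2 w
    have a3 : (K + 1 : ℝ) * ‖w‖ < 1 := by
      rw [le_div_iff₀ (by positivity)] at hw
      nlinarith [norm_nonneg w]
    rw [inner_smul_left, inner_smul_left, inner_add_left, inner_add_left, h21,
      real_inner_self_eq_norm_sq, h2]
    simp only [conj_trivial, zero_add, abs_mul, abs_of_pos ht]
    have a4 := neg_abs_le (inner ℝ w e₂ : ℝ)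
    have : (K : ℝ) * |inner ℝ w e₁| < 1 ^ 2 + inner ℝ w e₂ := by nlinarith
    nlinarith
  have hlip : ∀ a b : ℝ, |f a - f b| ≤ K * |a - b| := fun a b => by
    simpa [Real.dist_eq] using hf.dist_le_mul a b
  have hκ1 : 1 / (K + 2 : ℝ) ≤ 1 := by rw [div_le_one (by positivity)]; linarith
  have hsize : ∀ x ∈ Metric.ball q (R / 4), ∀ w : Plane, ‖w‖ ≤ 1 / (K + 2 : ℝ) →
      ∀ t ∈ Ioo 0 (R / 4), ‖t • (e₂ + w)‖ < R / 2 ∧ ‖x - q‖ < R / 4 := by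
    intro x hx w hw t ht
    rw [mem_ball_iff_norm] at hx
    refine ⟨?_, hx⟩
    rw [norm_smul, Real.norm_eq_abs, abs_of_pos ht.1]
    have : ‖e₂ + w‖ ≤ 2 := (norm_add_le _ _).trans (by linarith)
    nlinarith [ht.1, ht.2]
  refine ⟨e₂, h2, 1 / (K + 2), by positivity, hκ1, R / 4, by positivity, ?_, ?_⟩
  · intro x hx hxb w hw t ht
    obtain ⟨s1, s2⟩ := hsize x hxb w hw t ht
    have hy : x + t • (e₂ + w) ∈ Metric.ball q R := by
      rw [mem_ball_iff_norm, add_sub_right_comm]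
      exact (norm_add_le _ _).trans_lt (by linarith)
    have hx0 : f (inner ℝ (x - q) e₁) ≤ inner ℝ (x - q) e₂ := by
      by_contra hc
      exact hext x (Metric.ball_subset_ball (by linarith) hxb) (not_le.1 hc) hx
    rw [h _ hy, add_sub_right_comm, inner_add_left, inner_add_left]
    have k := key w hw t ht.1
    have l := hlip (inner ℝ (x - q) e₁ + inner ℝ (t • (e₂ + w)) e₁) (inner ℝ (x - q) e₁)
    rw [add_sub_cancel_left] at l
    linarith [(abs_le.1 l).2]
  · intro x hx hxb w hw t ht
    obtain ⟨s1, s2⟩ := hsize x hxb w hw t ht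
    have hy : x - t • (e₂ + w) ∈ Metric.ball q R := by
      rw [mem_ball_iff_norm, sub_right_comm]
      exact (norm_sub_le _ _).trans_lt (by linarith)
    have hx0 : inner ℝ (x - q) e₂ ≤ f (inner ℝ (x - q) e₁) := by
      by_contra hc
      exact hx ((h x (Metric.ball_subset_ball (by linarith) hxb)).2 (not_le.1 hc))
    refine hext _ hy ?_
    rw [sub_right_comm, inner_sub_left (x - q), inner_sub_left (x - q)]
    have k := key w hw t ht.1
    have l := hlip (inner ℝ (x - q) e₁ - inner ℝ (t • (e₂ + w)) e₁) (inner ℝ (x - q) e₁)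
    rw [sub_sub_cancel_left, abs_neg] at l
    linarith [(abs_le.1 l).1]

/-- Bi-Lipschitz straightening of the boundary near a boundary point. -/
theorem exists_chart (hΩ : IsLipschitzDomain Ω) {q : Plane} (hq : q ∈ frontier Ω) :
    ∃ S : Plane ≃ₜ ℝ × ℝ, (∃ K, LipschitzWith K S) ∧ (∃ K, LipschitzWith K S.symm) ∧ S q = 0 ∧
      ∀ᶠ y in 𝓝 q, (y ∈ Ω ↔ 0 < (S y).2) ∧ (y ∈ frontier Ω ↔ (S y).2 = 0) := by
  obtain ⟨e₁, e₂, h1, h2, h12, R, hR, K, f, hf, hf0, h, hext⟩ := hΩ.exists_graph hq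
  let S₀ : Plane → ℝ × ℝ := fun y =>
    (inner ℝ (y - q) e₁, inner ℝ (y - q) e₂ - f (inner ℝ (y - q) e₁))
  let T₀ : ℝ × ℝ → Plane := fun p => q + (p.1 • e₁ + (p.2 + f p.1) • e₂)
  have hi : ∀ e : Plane, ‖e‖ = 1 → LipschitzWith 1 fun y : Plane => (inner ℝ (y - q) e : ℝ) := by
    intro e he
    refine LipschitzWith.of_dist_le_mul fun y z => ?_
    rw [Real.dist_eq, ← inner_sub_left, sub_sub_sub_cancel_right, dist_eq_norm]
    simpa using abs_inner_le_norm_of_unit he (y - z)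
  have hS : LipschitzWith (max 1 (1 + K * 1)) S₀ :=
    (hi e₁ h1).prodMk ((hi e₂ h2).sub (hf.comp (hi e₁ h1)))
  have hsm : ∀ e : Plane, ‖e‖ = 1 → LipschitzWith 1 fun t : ℝ => t • e := by
    intro e he
    refine LipschitzWith.of_dist_le_mul fun y z => ?_
    rw [dist_eq_norm, ← sub_smul, norm_smul, he, dist_eq_norm]; simp
  have hT : ∃ K', LipschitzWith K' T₀ :=
    ⟨_, (LipschitzWith.const q).add (((hsm e₁ h1).comp LipschitzWith.prod_fst).add
      ((hsm e₂ h2).comp (LipschitzWith.prod_snd.add (hf.comp LipschitzWith.prod_fst))))⟩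
  have hTS : Function.LeftInverse T₀ S₀ := by
    intro y
    simp only [S₀, T₀, sub_add_cancel]
    rw [← eq_sum_of_orthonormal_frame h1 h2 h12 (y - q)]; abel
  have hST : Function.RightInverse T₀ S₀ := by
    intro p
    simp only [S₀, T₀, add_sub_cancel_left]
    obtain ⟨i1, i2⟩ := inner_frame_combination h1 h2 h12 p.1 (p.2 + f p.1)
    rw [i1, i2]; simp
  let S : Plane ≃ₜ ℝ × ℝ :=
    { toFun := S₀, invFun := T₀, left_inv := hTS, right_inv := hST
      continuous_toFun := hS.continuous
      continuous_invFun := hT.choose_spec.continuous }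
  have hSΩ : ∀ y ∈ Metric.ball q R, (y ∈ Ω ↔ 0 < (S y).2) := by
    intro y hy
    rw [h y hy]; exact sub_pos.symm
  refine ⟨S, ⟨_, hS⟩, hT, ?_, ?_⟩
  · change S₀ q = 0
    simp [S₀, hf0]
  · filter_upwards [Metric.ball_mem_nhds q hR] with y hy
    refine ⟨hSΩ y hy, ?_⟩
    have hset : Ω ∩ Metric.ball q R = (S ⁻¹' (univ ×ˢ Ioi 0)) ∩ Metric.ball q R := by
      ext z
      simp only [mem_inter_iff, mem_preimage, mem_prod, mem_univ, true_and, mem_Ioi]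
      exact and_congr_left fun hz => hSΩ z hz
    -- Being a frontier point is a local property, and inside the ball Ω coincides with the preimage
    -- of the upper half plane.
    have hfr : y ∈ frontier Ω ↔ y ∈ frontier (S ⁻¹' (univ ×ˢ Ioi (0 : ℝ))) := by
      have e1 := frontier_inter_open_inter (s := Ω) (t := Metric.ball q R) Metric.isOpen_ball
      have e2 := frontier_inter_open_inter (s := S ⁻¹' (univ ×ˢ Ioi (0 : ℝ)))
        (t := Metric.ball q R) Metric.isOpen_ball
      rw [hset, e2] at e1
      have := congrArg (y ∈ ·) e1
      simpa [hy] using this.symm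
    rw [hfr, ← S.preimage_frontier, frontier_univ_prod_eq, frontier_Ioi]
    simp

end IsLipschitzDomain

/-! ### Bi-Lipschitz maps which push boundary points -/

/-- A compactly supported horizontal shear of the plane, moving the origin. -/
theorem exists_horizontal_push {ρ h : ℝ} (hh : |h| < ρ) :
    ∃ D : ℝ × ℝ ≃ ℝ × ℝ, (∃ K, LipschitzWith K D) ∧ (∃ K, LipschitzWith K D.symm) ∧
      (∀ p, (D p).2 = p.2) ∧ D 0 = (h, 0) ∧ ∀ p, ρ ≤ ‖p‖ → D p = p := by
  have hρ : 0 < ρ := (abs_nonneg h).trans_lt hh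
  let χ : ℝ × ℝ → ℝ := fun p => max 0 (1 - ‖p‖ / ρ)
  have hχ : ∀ p p', |χ p - χ p'| ≤ ‖p - p'‖ / ρ := by
    intro p p'
    refine (abs_max_sub_max_le_max _ _ _ _).trans ?_
    simp only [sub_self, abs_zero, sub_sub_sub_cancel_left, ← sub_div, abs_div, abs_of_pos hρ]
    refine max_le (by positivity) ?_
    rw [abs_sub_comm]
    gcongr
    exact abs_norm_sub_norm_le p p'
  let d : ℝ × ℝ → ℝ × ℝ := fun p => (p.1 + h * χ p, p.2)
  -- The tent χ has Lipschitz constant 1 / ρ, so the shear differs from the identity by a map of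
  -- constant |h| / ρ < 1; such a perturbation is invertible and bi-Lipschitz.
  let c : ℝ≥0 := ⟨|h| / ρ, by positivity⟩
  have hc : c < 1 := by
    rw [← NNReal.coe_lt_coe]; exact (div_lt_one hρ).2 hh
  have happrox : ∀ p p', ‖d p - d p' - (p - p')‖ ≤ c * ‖p - p'‖ := by
    intro p p'
    have : d p - d p' - (p - p') = (h * (χ p - χ p'), 0) := by
      ext <;> simp [d]; ring
    rw [this, Prod.norm_mk, norm_zero, Real.norm_eq_abs, abs_mul]
    refine max_le ?_ (by positivity)
    calc |h| * |χ p - χ p'| ≤ |h| * (‖p - p'‖ / ρ) := by gcongr; exact hχ p p'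
      _ = |h| / ρ * ‖p - p'‖ := by ring
  have hA : ApproximatesLinearOn d (ContinuousLinearEquiv.refl ℝ (ℝ × ℝ) : ℝ × ℝ →L[ℝ] ℝ × ℝ)
      univ c := fun p _ p' _ => happrox p p'
  have hone : ‖((ContinuousLinearEquiv.refl ℝ (ℝ × ℝ)).symm : ℝ × ℝ →L[ℝ] ℝ × ℝ)‖₊ = 1 := by
    ext; simp
  have hc' : Subsingleton (ℝ × ℝ) ∨
      c < ‖((ContinuousLinearEquiv.refl ℝ (ℝ × ℝ)).symm : ℝ × ℝ →L[ℝ] ℝ × ℝ)‖₊⁻¹ := by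
    right; rw [hone, inv_one]; exact hc
  let D := (hA.toHomeomorph d hc').toEquiv
  have hD : ∀ p, D p = d p := fun p => rfl
  refine ⟨D, ⟨1 + c, LipschitzWith.of_dist_le_mul fun p p' => ?_⟩, ⟨(1 - c)⁻¹, ?_⟩, fun p => rfl,
    ?_, ?_⟩
  · rw [hD, hD, dist_eq_norm, dist_eq_norm]
    have := norm_add_le (d p - d p' - (p - p')) (p - p')
    rw [sub_add_cancel] at this
    have h2 := happrox p p'
    push_cast
    linarith
  · have hanti : AntilipschitzWith (1 - c)⁻¹ D := by
      refine AntilipschitzWith.of_le_mul_dist fun p p' => ?_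
      rw [hD, hD, dist_eq_norm, dist_eq_norm, NNReal.coe_inv, NNReal.coe_sub hc.le]
      have := norm_sub_le (d p - d p') (d p - d p' - (p - p'))
      rw [sub_sub_cancel] at this
      have h2 := happrox p p'
      have hc1 : (c : ℝ) < 1 := hc
      rw [inv_mul_eq_div, le_div_iff₀ (by simpa using hc1)]
      push_cast
      linarith
    exact hanti.to_rightInverse D.right_inv
  · simp [hD, d, χ]
  · intro p hp
    have : χ p = 0 := by
      simp only [χ]; rw [max_eq_left]
      rw [sub_nonpos, le_div_iff₀ hρ]; linarith
    rw [hD]; simp [d, this]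

/-- The bi-Lipschitz maps of the plane which preserve `Ω` and fix the points of `F`. -/
def fixingMaps (Ω F : Set Plane) : Set (Plane ≃ Plane) :=
  {B | (∃ K, LipschitzWith K B) ∧ (∃ K, LipschitzWith K B.symm) ∧ (∀ x, B x ∈ Ω ↔ x ∈ Ω) ∧
    ∀ x ∈ F, B x = x}

theorem refl_mem_fixingMaps (Ω F : Set Plane) : Equiv.refl Plane ∈ fixingMaps Ω F :=
  ⟨⟨1, LipschitzWith.id⟩, ⟨1, LipschitzWith.id⟩, fun _ => Iff.rfl, fun _ _ => rfl⟩

theorem symm_mem_fixingMaps {Ω F : Set Plane} {B : Plane ≃ Plane} (hB : B ∈ fixingMaps Ω F) :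
    B.symm ∈ fixingMaps Ω F := by
  obtain ⟨h1, h2, h3, h4⟩ := hB
  refine ⟨h2, h1, fun x => ?_, fun x hx => ?_⟩
  · rw [← h3, B.apply_symm_apply]
  · rw [B.symm_apply_eq, h4 x hx]

theorem trans_mem_fixingMaps {Ω F : Set Plane} {A B : Plane ≃ Plane} (hA : A ∈ fixingMaps Ω F)
    (hB : B ∈ fixingMaps Ω F) : A.trans B ∈ fixingMaps Ω F := by
  obtain ⟨⟨K, h1⟩, ⟨K', h2⟩, h3, h4⟩ := hA
  obtain ⟨⟨L, g1⟩, ⟨L', g2⟩, g3, g4⟩ := hB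
  exact ⟨⟨_, g1.comp h1⟩, ⟨_, h2.comp g2⟩, fun x => (g3 _).trans (h3 x), fun x hx => by
    rw [Equiv.trans_apply, h4 x hx, g4 x hx]⟩

theorem fixingMaps_anti {Ω F G : Set Plane} (h : F ⊆ G) : fixingMaps Ω G ⊆ fixingMaps Ω F :=
  fun _ hB => ⟨hB.1, hB.2.1, hB.2.2.1, fun x hx => hB.2.2.2 x (h hx)⟩

/-- In a straightening chart a horizontal shear supported near the origin preserves the upper half
plane and slides the origin along its edge. A small support keeps it away from F and inside the
region where the chart describes Ω. -/
theorem IsLipschitzDomain.eventually_exists_fixingMaps {Ω F : Set Plane}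
    (hΩ : IsLipschitzDomain Ω) (hF : IsClosed F) {q : Plane} (hq : q ∈ frontier Ω) (hqF : q ∉ F) :
    ∀ᶠ y in 𝓝[frontier Ω] q, ∃ B ∈ fixingMaps Ω F, B q = y := by
  obtain ⟨S, ⟨K, hK⟩, ⟨K', hK'⟩, hSq, hS⟩ := hΩ.exists_chart hq
  have hU : ∀ᶠ y in 𝓝 q, (y ∈ Ω ↔ 0 < (S y).2) ∧ y ∉ F := by
    filter_upwards [hS, hF.isOpen_compl.mem_nhds hqF] with y hy hy'
    exact ⟨hy.1, hy'⟩
  have hsq : S.symm 0 = q := by rw [← hSq, S.symm_apply_apply]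
  have hU' : ∀ᶠ p in 𝓝 (0 : ℝ × ℝ), (S.symm p ∈ Ω ↔ 0 < p.2) ∧ S.symm p ∉ F := by
    have := (S.symm.continuous.tendsto 0).eventually (hsq.symm ▸ hU)
    simpa using this
  obtain ⟨ρ, hρ, hball⟩ := Metric.eventually_nhds_iff.1 hU'
  have hcont : ∀ᶠ y in 𝓝 q, ‖S y‖ < ρ := by
    have := (S.continuous.norm.tendsto q)
    rw [hSq, norm_zero] at this
    exact this.eventually_lt_const hρ
  filter_upwards [nhdsWithin_le_nhds hS, nhdsWithin_le_nhds hcont, self_mem_nhdsWithin]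
    with y hy1 hy2 hy3
  have hy0 : (S y).2 = 0 := hy1.2.1 hy3
  have habs : |(S y).1| < ρ := (norm_fst_le (S y)).trans_lt hy2
  obtain ⟨D, ⟨L, hL⟩, ⟨L', hL'⟩, hD2, hD0, hDid⟩ := exists_horizontal_push habs
  have hdist : ∀ p : ℝ × ℝ, dist p 0 = ‖p‖ := fun p => by simp
  refine ⟨S.toEquiv.trans (D.trans S.symm.toEquiv), ⟨⟨_, hK'.comp (hL.comp hK)⟩,
    ⟨_, hK'.comp (hL'.comp hK)⟩, fun x => ?_, fun x hx => ?_⟩, ?_⟩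
  · change S.symm (D (S x)) ∈ Ω ↔ x ∈ Ω
    by_cases hx : ρ ≤ ‖S x‖
    · rw [hDid _ hx, S.symm_apply_apply]
    -- An injective map that is the identity outside the ball cannot send a point of the ball
    -- outside.
    · have hx' : ‖D (S x)‖ < ρ := by
        by_contra hc
        rw [not_lt] at hc
        have := D.injective (hDid _ hc)
        rw [this] at hc
        exact hx hc
      rw [(hball (by rw [hdist]; exact hx')).1, hD2]
      have := (hball (y := S x) (by rw [hdist]; exact not_le.1 hx)).1
      rw [S.symm_apply_apply] at this
      exact this.symm
  · change S.symm (D (S x)) = x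
    have hx : ρ ≤ ‖S x‖ := by
      by_contra hc
      have := (hball (y := S x) (by rw [hdist]; exact not_le.1 hc)).2
      rw [S.symm_apply_apply] at this
      exact this hx
    rw [hDid _ hx, S.symm_apply_apply]
  · change S.symm (D (S q)) = y
    rw [hSq, hD0, S.symm_apply_eq]
    ext
    · rfl
    · exact hy0.symm

/-- Two points in a connected part of the boundary which avoids `F` are related by a bi-Lipschitz
map which preserves the domain and fixes `F`. -/
theorem IsLipschitzDomain.exists_fixingMaps {Ω F K : Set Plane}
    (hΩ : IsLipschitzDomain Ω) (hF : IsClosed F) (hK : IsPreconnected K) (hKΩ : K ⊆ frontier Ω)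
    (hKF : Disjoint K F) {p q : Plane} (hp : p ∈ K) (hq : q ∈ K) :
    ∃ B ∈ fixingMaps Ω F, B p = q := by
  -- Being related by a fixing map is an equivalence relation, and each point of K is related to all
  -- nearby points of K; on a connected set there is then a single class.
  refine hK.induction₂ (fun p q => ∃ B ∈ fixingMaps Ω F, B p = q) ?_ ?_ ?_ hp hq
  · intro x hx
    exact nhdsWithin_mono _ hKΩ
      (hΩ.eventually_exists_fixingMaps hF (hKΩ hx) (disjoint_left.1 hKF hx))
  · rintro x y z - - - ⟨A, hA, rfl⟩ ⟨B, hB, rfl⟩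
    exact ⟨_, trans_mem_fixingMaps hA hB, rfl⟩
  · rintro x y - - ⟨A, hA, rfl⟩
    exact ⟨_, symm_mem_fixingMaps hA, A.symm_apply_apply x⟩

/-! ### The map `Ψ` of a polytopal model and its inverse -/

namespace IsPolytopalModel

variable {Ω P : Set Plane} {Ψ : Plane → Plane}

theorem isCompact_closure (h : IsPolytopalModel Ω P Ψ) : IsCompact (closure P) :=
  h.regular.1.isBounded.isCompact_closure

theorem continuousOn (h : IsPolytopalModel Ω P Ψ) : ContinuousOn Ψ (closure P) :=
  h.lipschitz.choose_spec.continuousOn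

theorem isCompact_closure_domain (h : IsPolytopalModel Ω P Ψ) : IsCompact (closure Ω) := by
  rw [← h.bijOn_closure.image_eq]
  exact h.isCompact_closure.image_of_continuousOn h.continuousOn

theorem bijOn_frontier (h : IsPolytopalModel Ω P Ψ) (hΩ : IsOpen Ω) :
    BijOn Ψ (frontier P) (frontier Ω) := by
  rw [hΩ.frontier_eq, h.regular.1.isOpen.frontier_eq]
  refine ⟨fun x hx => ⟨h.bijOn_closure.mapsTo hx.1, fun hxΩ => ?_⟩,
    h.bijOn_closure.injOn.mono sdiff_subset, fun y hy => ?_⟩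
  · obtain ⟨z, hz, hzx⟩ := h.bijOn.surjOn hxΩ
    rw [h.bijOn_closure.injOn (subset_closure hz) hx.1 hzx] at hz
    exact hx.2 hz
  · obtain ⟨x, hx, rfl⟩ := h.bijOn_closure.surjOn hy.1
    exact ⟨x, ⟨hx, fun hxP => hy.2 (h.bijOn.mapsTo hxP)⟩, rfl⟩

theorem invOn (h : IsPolytopalModel Ω P Ψ) :
    InvOn (modelInverse P Ψ) Ψ (closure P) (closure Ω) :=
  h.bijOn_closure.invOn_invFunOn

theorem bijOn_inverse_closure (h : IsPolytopalModel Ω P Ψ) :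
    BijOn (modelInverse P Ψ) (closure Ω) (closure P) :=
  h.bijOn_closure.symm h.invOn.symm

theorem bijOn_inverse (h : IsPolytopalModel Ω P Ψ) : BijOn (modelInverse P Ψ) Ω P :=
  h.bijOn.symm (h.invOn.symm.mono subset_closure subset_closure)

theorem bijOn_inverse_frontier (h : IsPolytopalModel Ω P Ψ) (hΩ : IsOpen Ω) :
    BijOn (modelInverse P Ψ) (frontier Ω) (frontier P) :=
  (h.bijOn_frontier hΩ).symm (h.invOn.symm.mono frontier_subset_closure frontier_subset_closure)

/-- A continuous bijection from a compact set to a Hausdorff space is closed, so preimages of closed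
sets under the inverse are closed. -/
theorem continuousOn_inverse (h : IsPolytopalModel Ω P Ψ) :
    ContinuousOn (modelInverse P Ψ) (closure Ω) := by
  rw [continuousOn_iff_isClosed]
  intro t ht
  refine ⟨Ψ '' (closure P ∩ t), ((h.isCompact_closure.inter_right ht).image_of_continuousOn
    (h.continuousOn.mono inter_subset_left)).isClosed, ?_⟩
  ext y
  simp only [mem_inter_iff, mem_preimage, mem_image, and_congr_left_iff]
  intro hy
  constructor
  · intro hyt
    exact ⟨_, ⟨h.bijOn_inverse_closure.mapsTo hy, hyt⟩, h.invOn.2 hy⟩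
  · rintro ⟨x, ⟨hx, hxt⟩, rfl⟩
    rwa [h.invOn.1 hx]

end IsPolytopalModel

/-! ### Vertices and edges of a polytope -/

theorem exists_smul_of_mem_segment {a b x y z : Plane} (hx : x ∈ segment ℝ a b)
    (hy : y ∈ segment ℝ a b) (hz : z ∈ segment ℝ a b) (hxy : x ≠ y) :
    ∃ r : ℝ, z - x = r • (y - x) := by
  rw [segment_eq_image_lineMap] at hx hy hz
  obtain ⟨s, -, rfl⟩ := hx
  obtain ⟨t, -, rfl⟩ := hy
  obtain ⟨τ, -, rfl⟩ := hz
  have hst : t - s ≠ 0 := by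
    rintro h; rw [sub_eq_zero] at h; exact hxy (by rw [h])
  refine ⟨(τ - s) / (t - s), ?_⟩
  simp only [AffineMap.lineMap_apply, vsub_eq_sub, vadd_eq_add, add_sub_add_right_eq_sub]
  rw [← sub_smul, ← sub_smul, smul_smul, div_mul_cancel₀ _ hst]

theorem not_linearIndependent_smul_smul (d : Plane) (r s : ℝ) :
    ¬ LinearIndependent ℝ ![r • d, s • d] := by
  intro h
  have h1 := LinearIndependent.pair_iff.1 h
  have h2 := h1 s (-r) (by rw [smul_smul, smul_smul, ← add_smul]; ring_nf; simp)
  have h3 := h1 1 0 (by rw [neg_eq_zero.1 h2.2]; simp)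
  exact one_ne_zero h3.1

theorem polytopeVertices_subset_frontier (P : Set Plane) : polytopeVertices P ⊆ frontier P := by
  rintro x ⟨u, v, -, hu, -⟩
  exact hu (left_mem_segment ℝ _ _)

namespace IsBoundedPolytope

variable {P : Set Plane}

/-- The segments are finitely many and closed, so those missing x also miss a neighbourhood of x. -/
theorem eventually_exists_segment {S : Finset (Plane × Plane)}
    (hS : frontier P = ⋃ s ∈ S, segment ℝ s.1 s.2) (x : Plane) :
    ∀ᶠ y in 𝓝 x, y ∈ frontier P → ∃ s ∈ S, x ∈ segment ℝ s.1 s.2 ∧ y ∈ segment ℝ s.1 s.2 := by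
  have h : ∀ᶠ y in 𝓝 x, ∀ s ∈ S, y ∈ segment ℝ s.1 s.2 → x ∈ segment ℝ s.1 s.2 := by
    rw [Filter.eventually_all_finset]
    intro s _
    by_cases hx : x ∈ segment ℝ s.1 s.2
    · exact Eventually.of_forall fun _ _ => hx
    · have hc : IsClosed (segment ℝ s.1 s.2) := by
        rw [segment_eq_image_lineMap]
        exact (isCompact_Icc.image (AffineMap.lineMap_continuous)).isClosed
      filter_upwards [hc.isOpen_compl.mem_nhds hx] with y hy hy'
      exact absurd hy' hy
  filter_upwards [h] with y hy hyP
  rw [hS, mem_iUnion₂] at hyP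
  obtain ⟨s, hs, hys⟩ := hyP
  exact ⟨s, hs, hy s hs hys, hys⟩

theorem eventually_segment_subset (hP : IsBoundedPolytope P) (x : Plane) :
    ∀ᶠ y in 𝓝 x, y ∈ frontier P → segment ℝ x y ⊆ frontier P := by
  obtain ⟨S, hS⟩ := hP.frontier_eq
  filter_upwards [eventually_exists_segment hS x] with y hy hyP
  obtain ⟨s, hs, hxs, hys⟩ := hy hyP
  rw [hS]
  exact ((convex_segment s.1 s.2).segment_subset hxs hys).trans
    (subset_biUnion_of_mem (u := fun s : Plane × Plane => segment ℝ s.1 s.2) hs)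

/-- A vertex lies on two of the finitely many segments with independent directions. Two such
segments share only one point, so the number of pairs of segments bounds the number of vertices. -/
theorem finite_polytopeVertices (hP : IsBoundedPolytope P) : (polytopeVertices P).Finite := by
  obtain ⟨S, hS⟩ := hP.frontier_eq
  let A : (Plane × Plane) × (Plane × Plane) → Set Plane := fun p =>
    {x | x ∈ segment ℝ p.1.1 p.1.2 ∧ x ∈ segment ℝ p.2.1 p.2.2 ∧
      ∃ y ∈ segment ℝ p.1.1 p.1.2, ∃ z ∈ segment ℝ p.2.1 p.2.2,
        LinearIndependent ℝ ![y - x, z - x]}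
  have hA : ∀ p, (A p).Subsingleton := by
    rintro p x ⟨h1, h2, y, hy, z, hz, hli⟩ x' ⟨h1', h2', -⟩
    by_contra hne
    obtain ⟨r, hr⟩ := exists_smul_of_mem_segment h1 h1' hy hne
    obtain ⟨s, hs⟩ := exists_smul_of_mem_segment h2 h2' hz hne
    rw [hr, hs] at hli
    exact not_linearIndependent_smul_smul _ _ _ hli
  refine Set.Finite.subset ((S ×ˢ S).finite_toSet.biUnion fun p _ => (hA p).finite) ?_
  rintro x ⟨u, v, huv, hu, hv⟩
  have hdir : ∀ u : Plane, segment ℝ x (x + u) ⊆ frontier P →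
      ∃ s ∈ S, x ∈ segment ℝ s.1 s.2 ∧ ∃ τ : ℝ, 0 < τ ∧ x + τ • u ∈ segment ℝ s.1 s.2 := by
    intro u hu
    have hc : Tendsto (fun τ : ℝ => x + τ • u) (𝓝 0) (𝓝 x) := by
      have : Continuous fun τ : ℝ => x + τ • u := by fun_prop
      simpa using this.tendsto 0
    have h1 := (hc.eventually (eventually_exists_segment hS x)).filter_mono
      (nhdsWithin_le_nhds (s := Ioi 0))
    obtain ⟨τ, hτ, hτ0, hτ1⟩ := (h1.and (Ioo_mem_nhdsGT (zero_lt_one (α := ℝ)))).exists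
    obtain ⟨s, hs, hxs, hys⟩ := hτ (hu (by
      rw [segment_eq_image']; exact ⟨τ, ⟨hτ0.le, hτ1.le⟩, by simp⟩))
    exact ⟨s, hs, hxs, τ, hτ0, hys⟩
  obtain ⟨s, hs, hxs, τ, hτ, hys⟩ := hdir u hu
  obtain ⟨s', hs', hxs', τ', hτ', hys'⟩ := hdir v hv
  refine mem_biUnion (x := (s, s')) (by simp [hs, hs']) ⟨hxs, hxs', _, hys, _, hys', ?_⟩
  simp only [add_sub_cancel_left]
  rw [LinearIndependent.pair_iff] at huv ⊢
  intro p q hpq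
  rw [smul_smul, smul_smul] at hpq
  obtain ⟨e1, e2⟩ := huv _ _ hpq
  exact ⟨(mul_eq_zero.1 e1).resolve_right hτ.ne', (mul_eq_zero.1 e2).resolve_right hτ'.ne'⟩

/-- Nearby boundary points are joined to x by segments of the boundary; two such segments in
independent directions would make x a vertex. If x is an isolated boundary point, any direction will
do. -/
theorem exists_line (hP : IsBoundedPolytope P) {x : Plane} (hx : x ∉ polytopeVertices P) :
    ∃ u : Plane, u ≠ 0 ∧ ∀ᶠ y in 𝓝 x, y ∈ frontier P → ∃ t : ℝ, y = x + t • u := by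
  obtain ⟨N, hN, hN'⟩ := (hP.eventually_segment_subset x).exists_mem
  by_cases h : ∃ y ∈ N, y ∈ frontier P ∧ y ≠ x
  · obtain ⟨y, hyN, hyP, hyx⟩ := h
    refine ⟨y - x, sub_ne_zero.2 hyx, ?_⟩
    filter_upwards [hN] with z hzN hzP
    by_contra hcon
    refine hx ⟨y - x, z - x, ?_, by simpa using hN' y hyN hyP, by simpa using hN' z hzN hzP⟩
    rw [LinearIndependent.pair_iff' (sub_ne_zero.2 hyx)]
    intro a ha
    exact hcon ⟨a, by rw [ha]; abel⟩
  · push Not at h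
    refine ⟨EuclideanSpace.single 0 1, by simp, ?_⟩
    filter_upwards [hN] with z hzN hzP
    exact ⟨0, by simp [h z hzN hzP]⟩

end IsBoundedPolytope

/-- Near a boundary point which is not a vertex, the boundary of the polytope is a straight line. -/
theorem IsPolytopalModel.exists_line_eventually {Ω P : Set Plane} {Ψ : Plane → Plane}
    (h : IsPolytopalModel Ω P Ψ) (hΩ : IsLipschitzDomain Ω) {x : Plane} (hxP : x ∈ frontier P)
    (hx : x ∉ polytopeVertices P) :
    ∃ u : Plane, u ≠ 0 ∧ (∀ᶠ y in 𝓝 x, y ∈ frontier P → ∃ t : ℝ, y = x + t • u) ∧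
      ∀ᶠ t in 𝓝 (0 : ℝ), x + t • u ∈ frontier P := by
  obtain ⟨u, hu, hline⟩ := h.regular.1.exists_line hx
  refine ⟨u, hu, hline, ?_⟩
  have hq := (h.bijOn_frontier hΩ.isOpen).mapsTo hxP
  have hxc := frontier_subset_closure hxP
  obtain ⟨S, -, -, hSq, hS⟩ := hΩ.exists_chart hq
  have hSs : S.symm 0 = Ψ x := by rw [← hSq, S.symm_apply_apply]
  -- It remains to show that the boundary fills the line near x. The boundary of Ω near Ψ x contains
  -- a curve γ; its pull-back c is injective and stays in the line, so its coordinate `k ∘ c` is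
  -- strictly monotone and covers a neighbourhood of 0.
  let γ : ℝ → Plane := fun t => S.symm (t, 0)
  have hγ : Continuous γ := S.symm.continuous.comp (by fun_prop)
  have hγ0 : γ 0 = Ψ x := hSs
  have hev : ∀ᶠ t in 𝓝 (0 : ℝ), γ t ∈ frontier Ω := by
    have := (hγ.tendsto 0).eventually (hγ0.symm ▸ hS)
    filter_upwards [this] with t ht
    rw [ht.2]; simp [γ]
  let c : ℝ → Plane := fun t => modelInverse P Ψ (γ t)
  have hc0 : c 0 = x := by simp only [c, hγ0]; exact h.invOn.1 hxc
  have hcont : ∀ᶠ t in 𝓝 (0 : ℝ), ContinuousAt c t := by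
    filter_upwards [hev.eventually_nhds] with t ht
    have h1 := h.continuousOn_inverse (γ t) (frontier_subset_closure ht.self_of_nhds)
    refine h1.tendsto.comp (tendsto_nhdsWithin_iff.2 ⟨hγ.tendsto t, ?_⟩)
    filter_upwards [ht] with s hs using frontier_subset_closure hs
  have hcl : ∀ᶠ t in 𝓝 (0 : ℝ), c t ∈ frontier P → ∃ s : ℝ, c t = x + s • u := by
    have := hcont.self_of_nhds.tendsto
    rw [hc0] at this
    exact this.eventually hline
  obtain ⟨δ, hδ, hball⟩ := Metric.eventually_nhds_iff.1 (hev.and (hcont.and hcl))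
  have hI : ∀ t ∈ Icc (-(δ / 2)) (δ / 2), γ t ∈ frontier Ω ∧ ContinuousAt c t ∧
      ∃ s : ℝ, c t = x + s • u := by
    intro t ht
    have := @hball t (by rw [Real.dist_eq, sub_zero]; linarith [abs_le.2 ht])
    exact ⟨this.1, this.2.1, this.2.2 ((h.bijOn_inverse_frontier hΩ.isOpen).mapsTo this.1)⟩
  let k : Plane → ℝ := fun y => inner ℝ (y - x) u / ‖u‖ ^ 2
  have hk : ∀ s : ℝ, k (x + s • u) = s := by
    intro s
    simp only [k, add_sub_cancel_left, inner_smul_left, real_inner_self_eq_norm_sq, conj_trivial]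
    rw [mul_div_cancel_right₀]
    exact pow_ne_zero 2 (norm_ne_zero_iff.2 hu)
  have hkc : Continuous k := by fun_prop
  have hη : ContinuousOn (k ∘ c) (Icc (-(δ / 2)) (δ / 2)) := fun t ht =>
    (hkc.continuousAt.comp (hI t ht).2.1).continuousWithinAt
  have hinj : InjOn (k ∘ c) (Icc (-(δ / 2)) (δ / 2)) := by
    intro t ht t' ht' htt
    obtain ⟨g1, -, s, hs⟩ := hI t ht
    obtain ⟨g2, -, s', hs'⟩ := hI t' ht'
    simp only [Function.comp, hs, hs', hk] at htt
    have : c t = c t' := by rw [hs, hs', htt]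
    have := (h.bijOn_inverse_frontier hΩ.isOpen).injOn g1 g2 this
    simpa [γ] using this
  have h0 : (k ∘ c) 0 = 0 := by
    have := hk 0
    simp only [zero_smul, add_zero] at this
    simp [hc0, this]
  have hle : -(δ / 2) ≤ δ / 2 := by linarith
  have hnhds : uIcc ((k ∘ c) (-(δ / 2))) ((k ∘ c) (δ / 2)) ∈ 𝓝 (0 : ℝ) := by
    rcases hη.strictMonoOn_of_injOn_Icc' hle hinj with hm | hm
    · have a1 := hm (left_mem_Icc.2 hle) ⟨by linarith, by linarith⟩ (show -(δ / 2) < 0 by linarith)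
      have a2 := hm ⟨by linarith, by linarith⟩ (right_mem_Icc.2 hle) (show 0 < δ / 2 by linarith)
      rw [h0] at a1 a2
      rw [uIcc_of_le (a1.trans a2).le]
      exact Icc_mem_nhds a1 a2
    · have a1 := hm (left_mem_Icc.2 hle) ⟨by linarith, by linarith⟩ (show -(δ / 2) < 0 by linarith)
      have a2 := hm ⟨by linarith, by linarith⟩ (right_mem_Icc.2 hle) (show 0 < δ / 2 by linarith)
      rw [h0] at a1 a2
      rw [uIcc_of_ge (a2.trans a1).le]
      exact Icc_mem_nhds a2 a1
  filter_upwards [hnhds] with t ht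
  have hivt := intermediate_value_uIcc (a := -(δ / 2)) (b := δ / 2) (f := k ∘ c)
    (by rw [uIcc_of_le hle]; exact hη)
  obtain ⟨τ, hτ, hτt⟩ := hivt ht
  rw [uIcc_of_le hle] at hτ
  obtain ⟨g1, -, s, hs⟩ := hI τ hτ
  simp only [Function.comp, hs, hk] at hτt
  rw [← hτt, ← hs]
  exact (h.bijOn_inverse_frontier hΩ.isOpen).mapsTo g1

/-- The segment with end points `a` and `b` is an edge of `P`: its end points are vertices, and
without them it is an open part of the boundary which contains no vertex. -/
structure IsPolytopeEdge (P : Set Plane) (a b : Plane) : Prop where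
  left_mem : a ∈ polytopeVertices P
  right_mem : b ∈ polytopeVertices P
  ne : a ≠ b
  subset : openSegment ℝ a b ⊆ frontier P \ polytopeVertices P
  eventually_mem : ∀ y ∈ openSegment ℝ a b, ∀ᶠ z in 𝓝 y, z ∈ frontier P → z ∈ openSegment ℝ a b

theorem IsPolytopeEdge.symm {P : Set Plane} {a b : Plane} (h : IsPolytopeEdge P a b) :
    IsPolytopeEdge P b a where
  left_mem := h.right_mem
  right_mem := h.left_mem
  ne := h.ne.symm
  subset := by rw [openSegment_symm]; exact h.subset
  eventually_mem := by rw [openSegment_symm]; exact h.eventually_mem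

theorem mem_openSegment_line_iff {x u : Plane} {α β : ℝ} (hα : 0 < α) (hβ : 0 < β) {y : Plane} :
    y ∈ openSegment ℝ (x + (-α) • u) (x + β • u) ↔ ∃ t ∈ Ioo (-α) β, y = x + t • u := by
  constructor
  · rintro ⟨p, q, hp, hq, hpq, rfl⟩
    refine ⟨q * β - p * α, ⟨?_, ?_⟩, ?_⟩
    · nlinarith
    · nlinarith
    · have : p = 1 - q := by linarith
      subst this
      module
  · rintro ⟨t, ⟨h1, h2⟩, rfl⟩
    have hs : α + β ≠ 0 := by positivity
    refine ⟨(β - t) / (α + β), (t + α) / (α + β), div_pos (by linarith) (by linarith),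
      div_pos (by linarith) (by linarith), by field_simp; ring, ?_⟩
    have e : ((β - t) / (α + β)) = 1 - (t + α) / (α + β) := by field_simp; ring
    have e2 : (t + α) / (α + β) * (α + β) = t + α := by field_simp
    have e3 : t = (t + α) / (α + β) * (α + β) - α := by rw [e2]; ring
    rw [e]
    generalize (t + α) / (α + β) = θ at *
    rw [e3]
    module

/-! ### Prolonging a straight piece of the boundary up to vertices -/

section maximal

variable {Fr V : Set Plane}

/-- The line through `x` with direction `u` is locally the set `Fr` near `x + t • u`. -/
def onLine (Fr V : Set Plane) (x u : Plane) : Set ℝ :=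
  {t | x + t • u ∈ Fr ∧ x + t • u ∉ V ∧
    ∀ᶠ y in 𝓝 (x + t • u), y ∈ Fr → ∃ s : ℝ, y = x + s • u}

/-- If a set is locally contained in a line and has points accumulating at p in the direction w, the
line must have direction w. This lets local lines at different points be identified. -/
theorem exists_smul_of_eventually {p u w : Plane} (hw : w ≠ 0)
    (h1 : ∀ᶠ y in 𝓝 p, y ∈ Fr → ∃ s : ℝ, y = p + s • u)
    (h2 : ∃ᶠ t in 𝓝[≠] (0 : ℝ), p + t • w ∈ Fr) : ∃ l : ℝ, l ≠ 0 ∧ u = l • w := by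
  have hc : Tendsto (fun τ : ℝ => p + τ • w) (𝓝[≠] 0) (𝓝 p) := by
    have : Continuous fun τ : ℝ => p + τ • w := by fun_prop
    have := this.tendsto 0
    simp only [zero_smul, add_zero] at this
    exact this.mono_left nhdsWithin_le_nhds
  obtain ⟨τ, hτ, hτ', hτ0⟩ :=
    (h2.and_eventually ((hc.eventually h1).and self_mem_nhdsWithin)).exists
  obtain ⟨s, hs⟩ := hτ' hτ
  have hs' : τ • w = s • u := add_left_cancel hs
  have hτ0' : τ ≠ 0 := hτ0
  have hs0 : s ≠ 0 := by
    rintro rfl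
    rw [zero_smul] at hs'
    exact (smul_ne_zero hτ0' hw) hs'
  refine ⟨s⁻¹ * τ, mul_ne_zero (inv_ne_zero hs0) hτ0', ?_⟩
  rw [mul_smul, hs', inv_smul_smul₀ hs0]

theorem exists_eq_add_smul_shift {x u y : Plane} (t : ℝ) :
    (∃ s : ℝ, y = x + s • u) ↔ ∃ s : ℝ, y = x + t • u + s • u := by
  constructor
  · rintro ⟨s, rfl⟩; exact ⟨s - t, by module⟩
  · rintro ⟨s, rfl⟩; exact ⟨t + s, by module⟩

theorem isOpen_onLine (hV : IsClosed V) (hloc : ∀ x ∈ Fr, x ∉ V → ∃ u : Plane, u ≠ 0 ∧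
      (∀ᶠ y in 𝓝 x, y ∈ Fr → ∃ t : ℝ, y = x + t • u) ∧ ∀ᶠ t in 𝓝 (0 : ℝ), x + t • u ∈ Fr)
    (x u : Plane) : IsOpen (onLine Fr V x u) := by
  rw [isOpen_iff_mem_nhds]
  rintro t ⟨h1, h2, h3⟩
  obtain ⟨w, hw, -, hwF⟩ := hloc _ h1 h2
  obtain ⟨l, hl, rfl⟩ := exists_smul_of_eventually hw
    (h3.mono fun y hy hyF => (exists_eq_add_smul_shift t).1 (hy hyF))
    (hwF.filter_mono nhdsWithin_le_nhds).frequently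
  have hc : Continuous fun s : ℝ => x + s • l • w := by fun_prop
  have hc' : Tendsto (fun s : ℝ => (s - t) * l) (𝓝 t) (𝓝 0) := by
    have : Continuous fun s : ℝ => (s - t) * l := by fun_prop
    simpa using this.tendsto t
  filter_upwards [hc'.eventually hwF, (hc.tendsto t).eventually h3.eventually_nhds,
    (hc.tendsto t).eventually (hV.isOpen_compl.mem_nhds h2)] with s g1 g2 g3
  refine ⟨?_, g3, g2⟩
  convert g1 using 1
  module

/-- Follow the line until `onLine` first fails, at a finite time β since `Fr` is bounded. The limit
point is in `Fr` by closedness; outside V it would have a local line, necessarily of direction u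
because points accumulate from the left, and β would still be in `onLine`. -/
theorem exists_onLine_end (hF : IsClosed Fr) (hFb : Bornology.IsBounded Fr) (hV : IsClosed V)
    (hloc : ∀ x ∈ Fr, x ∉ V → ∃ u : Plane, u ≠ 0 ∧
      (∀ᶠ y in 𝓝 x, y ∈ Fr → ∃ t : ℝ, y = x + t • u) ∧ ∀ᶠ t in 𝓝 (0 : ℝ), x + t • u ∈ Fr)
    {x u : Plane} (hu : u ≠ 0) (h0 : 0 ∈ onLine Fr V x u) :
    ∃ β > 0, x + β • u ∈ V ∧ ∀ t ∈ Ico 0 β, t ∈ onLine Fr V x u := by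
  have hopen := isOpen_onLine hV hloc x u
  let W := (onLine Fr V x u)ᶜ ∩ Ici 0
  have hWc : IsClosed W := hopen.isClosed_compl.inter isClosed_Ici
  have hWne : W.Nonempty := by
    obtain ⟨R, hR⟩ := hFb.exists_norm_le
    refine ⟨(|R| + ‖x‖ + 1) / ‖u‖, fun hmem => ?_, by simp only [mem_Ici]; positivity⟩
    have h1 := hR _ hmem.1
    have h2 := norm_sub_norm_le (((|R| + ‖x‖ + 1) / ‖u‖) • u) (-x)
    rw [sub_neg_eq_add, add_comm _ x, norm_neg, norm_smul, Real.norm_eq_abs,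
      abs_of_nonneg (by positivity), div_mul_cancel₀ _ (norm_ne_zero_iff.2 hu)] at h2
    linarith [le_abs_self R]
  have hWb : BddBelow W := ⟨0, fun t ht => ht.2⟩
  have hβ := hWc.csInf_mem hWne hWb
  set β := sInf W
  have hlt : ∀ t ∈ Ico 0 β, t ∈ onLine Fr V x u := by
    intro t ht
    by_contra hc
    exact not_lt.2 (csInf_le hWb ⟨hc, ht.1⟩) ht.2
  have hβ0 : 0 < β := lt_of_le_of_ne hβ.2 fun h => hβ.1 (h ▸ h0)
  have hc : Continuous fun s : ℝ => x + s • u := by fun_prop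
  have hleft : ∀ᶠ s in 𝓝[<] β, x + s • u ∈ Fr := by
    filter_upwards [Ioo_mem_nhdsLT hβ0] with s hs
    exact (hlt s ⟨hs.1.le, hs.2⟩).1
  have hbF : x + β • u ∈ Fr :=
    hF.mem_of_tendsto ((hc.tendsto β).mono_left nhdsWithin_le_nhds) hleft
  refine ⟨β, hβ0, ?_, hlt⟩
  by_contra hbV
  obtain ⟨w, hw, hwl, -⟩ := hloc _ hbF hbV
  have hfr : ∃ᶠ s in 𝓝[≠] (0 : ℝ), x + β • u + s • u ∈ Fr := by
    have hm : Tendsto (fun s : ℝ => s - β) (𝓝[<] β) (𝓝[≠] 0) := by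
      refine tendsto_nhdsWithin_iff.2 ⟨?_, ?_⟩
      · have : Continuous fun s : ℝ => s - β := by fun_prop
        have := this.tendsto β
        rw [sub_self] at this
        exact this.mono_left nhdsWithin_le_nhds
      · filter_upwards [self_mem_nhdsWithin] with s hs
        exact sub_ne_zero.2 (ne_of_lt hs)
    refine hm.frequently (hleft.mono fun s hs => ?_).frequently
    convert hs using 1
    module
  obtain ⟨l, hl, rfl⟩ := exists_smul_of_eventually hu hwl hfr
  refine hβ.1 ⟨hbF, hbV, hwl.mono fun y hy hyF => ?_⟩
  obtain ⟨s, hs⟩ := hy hyF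
  exact ⟨β + s * l, by rw [hs]; module⟩

end maximal

/-- Prolong the local line at x in both directions to the first vertex on each side. -/
theorem IsPolytopalModel.exists_edge {Ω P : Set Plane} {Ψ : Plane → Plane}
    (h : IsPolytopalModel Ω P Ψ) (hΩ : IsLipschitzDomain Ω) {x : Plane} (hxP : x ∈ frontier P)
    (hx : x ∉ polytopeVertices P) :
    ∃ a b, IsPolytopeEdge P a b ∧ x ∈ openSegment ℝ a b := by
  have hloc := fun y (hy : y ∈ frontier P) (hyV : y ∉ polytopeVertices P) =>
    h.exists_line_eventually hΩ hy hyV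
  have hVc : IsClosed (polytopeVertices P) := h.regular.1.finite_polytopeVertices.isClosed
  have hFb : Bornology.IsBounded (frontier P) :=
    h.isCompact_closure.isBounded.subset frontier_subset_closure
  obtain ⟨u, hu, hul, -⟩ := hloc x hxP hx
  have h0 : 0 ∈ onLine (frontier P) (polytopeVertices P) x u := by
    simp only [onLine, mem_ofPred_eq, zero_smul, add_zero]; exact ⟨hxP, hx, hul⟩
  have hneg : ∀ t, t ∈ onLine (frontier P) (polytopeVertices P) x (-u) ↔
      -t ∈ onLine (frontier P) (polytopeVertices P) x u := by
    intro t
    have e : ∀ y : Plane, (∃ s : ℝ, y = x + s • (-u)) ↔ ∃ s : ℝ, y = x + s • u := fun y =>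
      ⟨fun ⟨s, hs⟩ => ⟨-s, by rw [hs]; module⟩, fun ⟨s, hs⟩ => ⟨-s, by rw [hs]; module⟩⟩
    simp only [onLine, mem_ofPred_eq, e]
    rw [smul_neg, ← neg_smul]
  obtain ⟨β, hβ, hβV, hβI⟩ := exists_onLine_end isClosed_frontier hFb hVc hloc hu h0
  obtain ⟨α, hα, hαV, hαI⟩ := exists_onLine_end isClosed_frontier hFb hVc hloc (neg_ne_zero.2 hu)
    ((hneg 0).2 (by simpa using h0))
  rw [smul_neg, ← neg_smul] at hαV
  have hI : ∀ t ∈ Ioo (-α) β, t ∈ onLine (frontier P) (polytopeVertices P) x u := by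
    intro t ht
    rcases le_or_gt 0 t with h0t | h0t
    · exact hβI t ⟨h0t, ht.2⟩
    · have := (hneg (-t)).1 (hαI (-t) ⟨by linarith, by linarith [ht.1]⟩)
      rwa [neg_neg] at this
  refine ⟨x + (-α) • u, x + β • u, ⟨hαV, hβV, ?_, ?_, ?_⟩, ?_⟩
  · intro he
    have h1 : (-α) • u = β • u := add_left_cancel he
    have := smul_left_injective ℝ hu h1
    linarith
  · intro y hy
    obtain ⟨t, ht, rfl⟩ := (mem_openSegment_line_iff hα hβ).1 hy
    exact ⟨(hI t ht).1, (hI t ht).2.1⟩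
  · intro y hy
    obtain ⟨t, ht, rfl⟩ := (mem_openSegment_line_iff hα hβ).1 hy
    let k : Plane → ℝ := fun y => inner ℝ (y - x) u / ‖u‖ ^ 2
    have hk : ∀ s : ℝ, k (x + s • u) = s := by
      intro s
      simp only [k, add_sub_cancel_left, inner_smul_left, real_inner_self_eq_norm_sq,
        conj_trivial]
      rw [mul_div_cancel_right₀]
      exact pow_ne_zero 2 (norm_ne_zero_iff.2 hu)
    have hkc : Continuous k := by fun_prop
    have hev : ∀ᶠ z in 𝓝 (x + t • u), k z ∈ Ioo (-α) β :=
      (hkc.tendsto _).eventually (by rw [hk]; exact Ioo_mem_nhds ht.1 ht.2)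
    filter_upwards [(hI t ht).2.2, hev] with z hz hkz hzF
    obtain ⟨s, rfl⟩ := hz hzF
    rw [hk] at hkz
    exact (mem_openSegment_line_iff hα hβ).2 ⟨s, hkz, rfl⟩
  · exact (mem_openSegment_line_iff hα hβ).2 ⟨0, ⟨by linarith, hβ⟩, by simp⟩

/-! ### Connected subsets of the boundary versus edges -/

theorem isClosed_segment_plane (c d : Plane) : IsClosed (segment ℝ c d) := by
  rw [segment_eq_image_lineMap]
  exact (isCompact_Icc.image (AffineMap.lineMap_continuous)).isClosed

/-- A connected set which meets a relatively open segment and avoids its end points is contained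
in the segment. -/
theorem IsPreconnected.subset_openSegment {Fr T : Set Plane} {c d : Plane}
    (hopen : ∀ y ∈ openSegment ℝ c d, ∀ᶠ z in 𝓝 y, z ∈ Fr → z ∈ openSegment ℝ c d)
    (hT : IsPreconnected T) (hTF : T ⊆ Fr) (hc : c ∉ T) (hd : d ∉ T) {y : Plane} (hyT : y ∈ T)
    (hy : y ∈ openSegment ℝ c d) : T ⊆ openSegment ℝ c d := by
  have hseg : ∀ z ∈ T, z ∈ segment ℝ c d → z ∈ openSegment ℝ c d := fun z hz hz' =>
    mem_openSegment_of_ne_left_right (fun e => hc (e ▸ hz)) (fun e => hd (e ▸ hz)) hz'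
  -- This open set meets T exactly in the open segment, since T avoids c and d. Together with the
  -- complement of the closed segment it splits T into two disjoint relatively open parts.
  let u := {y : Plane | ∀ᶠ z in 𝓝 y, z ∈ Fr → z ∈ openSegment ℝ c d}
  have hsub : ∀ z ∈ T, z ∈ u → z ∈ openSegment ℝ c d := fun z hz hzu =>
    Filter.Eventually.self_of_nhds hzu (hTF hz)
  have hcov : T ⊆ u ∪ (segment ℝ c d)ᶜ := by
    intro z hz
    by_cases hz' : z ∈ segment ℝ c d
    · exact Or.inl (hopen z (hseg z hz hz'))
    · exact Or.inr hz'
  have hdisj : T ∩ (u ∩ (segment ℝ c d)ᶜ) = ∅ := by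
    refine eq_empty_of_forall_notMem ?_
    rintro z ⟨hz, hzu, hz'⟩
    exact hz' (openSegment_subset_segment ℝ c d (hsub z hz hzu))
  rcases isPreconnected_iff_subset_of_disjoint.1 hT u (segment ℝ c d)ᶜ
    isOpen_setOfPred_eventually_nhds (isClosed_segment_plane c d).isOpen_compl hcov hdisj
    with h | h
  · exact fun z hz => hsub z hz (h hz)
  · exact absurd (openSegment_subset_segment ℝ c d hy) (h hyT)

theorem IsPolytopeEdge.subset_of_isPreconnected {P T : Set Plane} {a b : Plane}
    (he : IsPolytopeEdge P a b) (hT : IsPreconnected T) (hTF : T ⊆ frontier P)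
    (ha : a ∉ T) (hb : b ∉ T) {y : Plane} (hyT : y ∈ T) (hy : y ∈ openSegment ℝ a b) :
    T ⊆ openSegment ℝ a b :=
  hT.subset_openSegment he.eventually_mem hTF ha hb hyT hy

/-- An edge can only be left through its end points, which are vertices; so a connected, vertex-free
part of the boundary stays in one edge, and its closure meets no vertex but the ends. -/
theorem IsPolytopalModel.exists_edge_of_isPreconnected {Ω P T : Set Plane} {Ψ : Plane → Plane}
    (h : IsPolytopalModel Ω P Ψ) (hΩ : IsLipschitzDomain Ω) (hT : IsPreconnected T)
    (hTF : T ⊆ frontier P \ polytopeVertices P) (hne : T.Nonempty) :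
    ∃ a b, IsPolytopeEdge P a b ∧ T ⊆ openSegment ℝ a b ∧
      ∀ v ∈ polytopeVertices P, v ∈ closure T → v = a ∨ v = b := by
  obtain ⟨y, hy⟩ := hne
  obtain ⟨a, b, he, hyab⟩ := h.exists_edge hΩ (hTF hy).1 (hTF hy).2
  have hsub := he.subset_of_isPreconnected hT (fun z hz => (hTF hz).1)
    (fun ha => (hTF ha).2 he.left_mem) (fun hb => (hTF hb).2 he.right_mem) hy hyab
  refine ⟨a, b, he, hsub, fun v hv hvT => ?_⟩
  have hvs : v ∈ segment ℝ a b := closure_minimal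
    (hsub.trans (openSegment_subset_segment ℝ a b)) (isClosed_segment_plane a b) hvT
  by_contra hcon
  push Not at hcon
  exact (he.subset (mem_openSegment_of_ne_left_right hcon.1.symm hcon.2.symm hvs)).2 hv

/-- A homeomorphism of the boundary which fixes the vertices preserves every edge. -/
theorem IsPolytopalModel.mapsTo_edge {Ω P : Set Plane} {Ψ : Plane → Plane}
    (h : IsPolytopalModel Ω P Ψ) (hΩ : IsLipschitzDomain Ω) {g : Plane → Plane}
    (hg : ContinuousOn g (frontier P)) (hgi : InjOn g (frontier P))
    (hgm : MapsTo g (frontier P) (frontier P)) (hgV : ∀ v ∈ polytopeVertices P, g v = v)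
    {a b : Plane} (he : IsPolytopeEdge P a b) :
    MapsTo g (openSegment ℝ a b) (openSegment ℝ a b) := by
  have hV := polytopeVertices_subset_frontier P
  have hsubF : openSegment ℝ a b ⊆ frontier P := fun z hz => (he.subset hz).1
  have hsegF : segment ℝ a b ⊆ frontier P := by
    rw [← insert_endpoints_openSegment]
    exact insert_subset (hV he.left_mem) (insert_subset (hV he.right_mem) hsubF)
  have hcl : closure (openSegment ℝ a b) = segment ℝ a b := closure_openSegment a b
  obtain ⟨a', b', he', hsub, hends⟩ := h.exists_edge_of_isPreconnected hΩ
    ((convex_openSegment a b).isPreconnected.image g (hg.mono hsubF)) (by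
      rintro _ ⟨z, hz, rfl⟩
      refine ⟨hgm (hsubF hz), fun hgz => (he.subset hz).2 ?_⟩
      rwa [hgi (hsubF hz) (hV hgz) (hgV _ hgz).symm]) ⟨_, mem_image_of_mem g
        ⟨1 / 2, 1 / 2, by norm_num, by norm_num, by norm_num, rfl⟩⟩
  have hlim : ∀ v ∈ segment ℝ a b, g v ∈ closure (g '' openSegment ℝ a b) := by
    intro v hv
    refine ContinuousWithinAt.mem_closure_image ?_ (hcl.symm ▸ hv)
    exact (hg v (hsegF hv)).mono hsubF
  have ha := hends a he.left_mem (by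
    simpa [hgV a he.left_mem] using hlim a (left_mem_segment ℝ a b))
  have hb := hends b he.right_mem (by
    simpa [hgV b he.right_mem] using hlim b (right_mem_segment ℝ a b))
  have hab := he.ne
  -- The image of the open edge lies in one edge whose ends include the fixed points a and b, so it
  -- is the original edge up to orientation.
  rw [mapsTo_iff_image_subset]
  rcases ha with rfl | rfl <;> rcases hb with rfl | rfl
  · exact absurd rfl hab
  · exact hsub
  · exact hsub.trans (openSegment_symm ℝ _ _).subset
  · exact absurd rfl hab

/-! ### Maps of class `C¹` up to the boundary -/

theorem ContDiffWithinAt.exists_hasFDerivWithinAt_ball {f : Plane → Plane} {s : Set Plane}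
    {x : Plane} (h : ContDiffWithinAt ℝ 1 f s x) (hx : x ∈ s) :
    ∃ ρ > 0, ∃ f' : Plane → Plane →L[ℝ] Plane, ContinuousOn f' (s ∩ Metric.ball x ρ) ∧
      ∀ y ∈ s ∩ Metric.ball x ρ, HasFDerivWithinAt f (f' y) s y := by
  rw [← zero_add (1 : WithTop ℕ∞), contDiffWithinAt_succ_iff_hasFDerivWithinAt (by simp)] at h
  obtain ⟨u, hu, -, f', hf', hc⟩ := h
  rw [insert_eq_of_mem hx] at hu
  obtain ⟨w, hw, hcw⟩ := (contDiffWithinAt_zero (mem_of_mem_nhdsWithin hx hu)).1 hc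
  have hwu : u ∩ w ∈ 𝓝[s] x := inter_mem hu (by
    obtain ⟨O, hO, hOw⟩ := mem_nhdsWithin_iff_exists_mem_nhds_inter.1 hw
    filter_upwards [hu, nhdsWithin_le_nhds hO] with z hz hz' using hOw ⟨hz', hz⟩)
  obtain ⟨ρ, hρ, hball⟩ := Metric.mem_nhdsWithin_iff.1 hwu
  rw [inter_comm] at hball
  refine ⟨ρ, hρ, f', hcw.mono hball, fun y hy => ?_⟩
  have h1 : HasFDerivWithinAt f (f' y) (s ∩ Metric.ball x ρ) y :=
    (hf' y (hball hy).1).mono (fun z hz => (hball hz).1)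
  exact (hasFDerivWithinAt_inter (Metric.isOpen_ball.mem_nhds hy.2)).1 h1

/-- By compactness a local bound is enough. Near a boundary point the closure need not be convex, so
two points are joined by three segments: up along the cone axis, across, and down. Their total
length is comparable to the distance. -/
theorem IsLipschitzDomain.exists_lipschitzOnWith {Ω : Set Plane} (hΩ : IsLipschitzDomain Ω)
    (hc : IsCompact (closure Ω)) {Φ : Plane → Plane} (hΦ : ContDiffOn ℝ 1 Φ (closure Ω)) :
    ∃ K, LipschitzOnWith K Φ (closure Ω) := by
  refine LocallyLipschitzOn.exists_lipschitzOnWith_of_compact hc fun x hx => ?_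
  obtain ⟨ρ₀, hρ₀, f', hf'c, hf'⟩ := (hΦ x hx).exists_hasFDerivWithinAt_ball hx
  have hbd : ∀ᶠ y in 𝓝[closure Ω] x, ‖f' y‖ < ‖f' x‖ + 1 := by
    have h1 : ContinuousWithinAt f' (closure Ω) x :=
      (continuousWithinAt_inter (Metric.ball_mem_nhds x hρ₀)).1
        (hf'c x ⟨hx, Metric.mem_ball_self hρ₀⟩)
    exact h1.norm.eventually_lt_const (by linarith)
  obtain ⟨ρ₁, hρ₁, hball⟩ := Metric.mem_nhdsWithin_iff.1 hbd
  set ρ := min ρ₀ ρ₁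
  have hρ : 0 < ρ := lt_min hρ₀ hρ₁
  set D := ‖f' x‖ + 1
  have hD : 0 < D := by positivity
  have hseg : ∀ a b : Plane, segment ℝ a b ⊆ closure Ω ∩ Metric.ball x ρ →
      ‖Φ b - Φ a‖ ≤ D * ‖b - a‖ := by
    intro a b hab
    refine Convex.norm_image_sub_le_of_norm_hasFDerivWithin_le (𝕜 := ℝ) (f' := f') (s := segment ℝ a b)
      (fun y hy => ?_) (fun y hy => ?_) (convex_segment a b) (left_mem_segment ℝ a b)
      (right_mem_segment ℝ a b)
    · have := hab hy
      exact (hf' y ⟨this.1, Metric.ball_subset_ball (min_le_left _ _) this.2⟩).mono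
        fun z hz => (hab hz).1
    · have := hab hy
      exact le_of_lt (hball ⟨Metric.ball_subset_ball (min_le_right _ _) this.2, this.1⟩)
  by_cases hxΩ : x ∈ Ω
  · obtain ⟨δ, hδ, hδΩ⟩ := Metric.isOpen_iff.1 hΩ.isOpen x hxΩ
    refine ⟨⟨D, hD.le⟩, Metric.ball x (min δ ρ),
      mem_nhdsWithin_of_mem_nhds (Metric.ball_mem_nhds x (lt_min hδ hρ)),
      LipschitzOnWith.of_dist_le_mul fun y hy z hz => ?_⟩
    rw [dist_eq_norm, dist_eq_norm]
    refine hseg z y (((convex_ball x _).segment_subset hz hy).trans fun w hw => ⟨?_, ?_⟩)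
    · exact subset_closure (hδΩ (Metric.ball_subset_ball (min_le_left _ _) hw))
    · exact Metric.ball_subset_ball (min_le_right _ _) hw
  · have hxf : x ∈ frontier Ω := by rw [hΩ.isOpen.frontier_eq]; exact ⟨hx, hxΩ⟩
    obtain ⟨e, he, κ, hκ, hκ1, r, hr, hcone, -⟩ := hΩ.exists_cone hxf
    set m := min ρ r
    have hm : 0 < m := lt_min hρ hr
    -- This size makes the lift M below m / 3, and keeps all three segments within distance m of x.
    set δ := m * κ / 6
    have hδ : 0 < δ := by positivity
    have hδm : δ ≤ m / 6 := by simp only [δ]; nlinarith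
    refine ⟨⟨D * (1 + 2 / κ), by positivity⟩, closure Ω ∩ Metric.ball x δ,
      inter_mem_nhdsWithin _ (Metric.ball_mem_nhds x hδ),
      LipschitzOnWith.of_dist_le_mul fun y hy z hz => ?_⟩
    rw [dist_eq_norm, dist_eq_norm]
    change ‖Φ y - Φ z‖ ≤ D * (1 + 2 / κ) * ‖y - z‖
    rcases eq_or_ne y z with rfl | hyz
    · simp
    have hd : 0 < ‖y - z‖ := norm_pos_iff.2 (sub_ne_zero.2 hyz)
    have hyx := mem_ball_iff_norm.1 hy.2
    have hzx := mem_ball_iff_norm.1 hz.2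
    have hd2 : ‖y - z‖ < 2 * δ := by
      have : y - z = (y - x) - (z - x) := by abel
      rw [this]; exact (norm_sub_le _ _).trans_lt (by linarith)
    -- The lift is chosen so that (y - z) / M has norm κ: the horizontal segment then lies in the
    -- cone with apex z.
    set M := ‖y - z‖ / κ
    have hM : 0 < M := by positivity
    have hMm : M < m / 3 := by
      simp only [M]; rw [div_lt_iff₀ hκ]; simp only [δ] at hd2; linarith
    have hmρ : m ≤ ρ := min_le_left _ _
    have hmr : m ≤ r := min_le_right _ _
    have hvert : ∀ a ∈ closure Ω ∩ Metric.ball x δ,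
        segment ℝ a (a + M • e) ⊆ closure Ω ∩ Metric.ball x ρ := by
      rintro a ⟨ha, hax⟩ w hw
      rw [segment_eq_image'] at hw
      obtain ⟨θ, hθ, rfl⟩ := hw
      have hax' := mem_ball_iff_norm.1 hax
      simp only [add_sub_cancel_left, smul_smul]
      constructor
      · rcases hθ.1.eq_or_lt with h0 | h0
        · simpa [← h0] using ha
        · have := hcone a ha (Metric.ball_subset_ball (by linarith) hax) 0 (by simpa using hκ.le)
            (θ * M) ⟨by positivity, by nlinarith [hθ.2]⟩
          rw [add_zero] at this
          exact subset_closure this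
      · rw [mem_ball_iff_norm, add_sub_right_comm]
        refine (norm_add_le _ _).trans_lt ?_
        rw [norm_smul, he, mul_one, Real.norm_eq_abs, abs_of_nonneg (mul_nonneg hθ.1 hM.le)]
        nlinarith [hθ.2]
    have hhor : segment ℝ (z + M • e) (y + M • e) ⊆ closure Ω ∩ Metric.ball x ρ := by
      intro w hw
      rw [segment_eq_image'] at hw
      obtain ⟨θ, hθ, rfl⟩ := hw
      have hθn : ‖θ • (y - z)‖ ≤ ‖y - z‖ := by
        rw [norm_smul, Real.norm_eq_abs, abs_of_nonneg hθ.1]; nlinarith [hθ.2]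
      have heq : z + M • e + θ • (y + M • e - (z + M • e)) =
          z + M • (e + M⁻¹ • (θ • (y - z))) := by
        rw [smul_add, smul_inv_smul₀ hM.ne', add_sub_add_right_eq_sub]; abel
      simp only [heq]
      constructor
      · refine subset_closure (hcone z hz.1 (Metric.ball_subset_ball (by linarith) hz.2) _ ?_ M
          ⟨hM, by linarith⟩)
        rw [norm_smul, norm_inv, Real.norm_eq_abs, abs_of_pos hM, inv_mul_eq_div,
          div_le_iff₀ hM]
        refine hθn.trans (le_of_eq ?_)
        simp only [M]; field_simp
      · rw [mem_ball_iff_norm, smul_add, smul_inv_smul₀ hM.ne', add_sub_right_comm]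
        refine (norm_add_le _ _).trans_lt ?_
        have := norm_add_le (M • e) (θ • (y - z))
        rw [norm_smul, he, mul_one, Real.norm_eq_abs, abs_of_pos hM] at this
        linarith
    have i1 := hseg _ _ (hvert y hy)
    have i2 := hseg _ _ (hvert z hz)
    have i3 := hseg _ _ hhor
    rw [add_sub_cancel_left, norm_smul, he, mul_one, Real.norm_eq_abs, abs_of_pos hM] at i1 i2
    rw [add_sub_add_right_eq_sub] at i3
    have hsum : Φ y - Φ z = -(Φ (y + M • e) - Φ y) + (Φ (y + M • e) - Φ (z + M • e)) +
      (Φ (z + M • e) - Φ z) := by abel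
    rw [hsum]
    refine norm_add₃_le.trans ?_
    rw [norm_neg]
    have : D * (1 + 2 / κ) * ‖y - z‖ = D * M + D * ‖y - z‖ + D * M := by
      simp only [M]; ring
    rw [this]
    linarith

/-! ### Outward normals -/

theorem inner_nonpos_of_eventually {A : Set Plane} {y ν d : Plane}
    (hν : ∀ ε > 0, ∀ᶠ z in 𝓝 y, z ∈ A → inner ℝ (z - y) ν ≤ ε * ‖z - y‖)
    (hd : ∀ᶠ t in 𝓝[>] (0 : ℝ), y + t • d ∈ A) : inner ℝ d ν ≤ (0 : ℝ) := by
  by_contra hcon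
  rw [not_le] at hcon
  have hd0 : d ≠ 0 := by rintro rfl; simp at hcon
  have hdn : 0 < ‖d‖ := norm_pos_iff.2 hd0
  have hc : Tendsto (fun t : ℝ => y + t • d) (𝓝[>] 0) (𝓝 y) := by
    have : Continuous fun t : ℝ => y + t • d := by fun_prop
    have := this.tendsto 0
    simp only [zero_smul, add_zero] at this
    exact this.mono_left nhdsWithin_le_nhds
  obtain ⟨t, ht1, ht2, ht3⟩ := (hd.and ((hc.eventually
    (hν (inner ℝ d ν / (2 * ‖d‖)) (by positivity))).and self_mem_nhdsWithin)).exists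
  have ht0 : (0 : ℝ) < t := ht3
  have := ht2 ht1
  rw [add_sub_cancel_left, inner_smul_left, norm_smul, Real.norm_eq_abs, abs_of_pos ht0,
    conj_trivial] at this
  have e : inner ℝ d ν / (2 * ‖d‖) * (t * ‖d‖) = t * inner ℝ d ν / 2 := by field_simp
  rw [e] at this
  nlinarith [mul_pos ht0 hcon]

theorem eventually_closure_of_eventually {ω : Set Plane} {y ν : Plane} {ε : ℝ}
    (h : ∀ᶠ z in 𝓝 y, z ∈ ω → inner ℝ (z - y) ν ≤ ε * ‖z - y‖) :
    ∀ᶠ z in 𝓝 y, z ∈ closure ω → inner ℝ (z - y) ν ≤ ε * ‖z - y‖ := by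
  filter_upwards [h.eventually_nhds] with z hz hzω
  have hcl : IsClosed {z : Plane | inner ℝ (z - y) ν ≤ ε * ‖z - y‖} :=
    isClosed_le (by fun_prop) (by fun_prop)
  exact hcl.mem_of_frequently_of_tendsto
    ((mem_closure_iff_frequently.1 hzω).mp (hz.mono fun w hw hwω => hw hwω)) tendsto_id

theorem IsLipschitzDomain.frontier_subset_closure_compl {Ω : Set Plane}
    (hΩ : IsLipschitzDomain Ω) : frontier Ω ⊆ closure (closure Ω)ᶜ := by
  intro y hy
  obtain ⟨e, -, κ, hκ, -, r, hr, -, hcone⟩ := hΩ.exists_cone hy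
  rw [hΩ.isOpen.frontier_eq] at hy
  have hc : Tendsto (fun t : ℝ => y - t • e) (𝓝[>] 0) (𝓝 y) := by
    have : Continuous fun t : ℝ => y - t • e := by fun_prop
    have := this.tendsto 0
    simp only [zero_smul, sub_zero] at this
    exact this.mono_left nhdsWithin_le_nhds
  refine mem_closure_of_tendsto hc ?_
  filter_upwards [Ioo_mem_nhdsGT hr] with t ht
  have := hcone y hy.2 (Metric.mem_ball_self hr) 0 (by simpa using hκ.le) t ht
  rwa [add_zero] at this

/-- This form tests only points of the closure, hence can be transported by maps defined there. The
exterior condition passes to the frontier by density. Conversely, an exterior point is moved along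
the interior cone axis e until it hits the frontier; as e makes a nonpositive inner product with ν,
the lower bound there carries back. -/
theorem IsLipschitzDomain.isOutwardNormal_iff {Ω : Set Plane} (hΩ : IsLipschitzDomain Ω)
    {y ν : Plane} (hy : y ∈ frontier Ω) :
    IsOutwardNormal Ω y ν ↔ ‖ν‖ = 1 ∧ ∀ ε > 0, ∀ᶠ z in 𝓝 y,
      (z ∈ closure Ω → inner ℝ (z - y) ν ≤ ε * ‖z - y‖) ∧
      (z ∈ frontier Ω → -(ε * ‖z - y‖) ≤ inner ℝ (z - y) ν) := by
  refine and_congr_right fun hν1 => ⟨fun h ε hε => ?_, fun h ε hε => ?_⟩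
  · have h1 := eventually_closure_of_eventually ((h ε hε).mono fun z hz => hz.1)
    have h2 := eventually_closure_of_eventually (ω := (closure Ω)ᶜ) (ν := -ν) (ε := ε)
      ((h ε hε).mono fun z hz hz' => by rw [inner_neg_right]; linarith [hz.2 hz'])
    filter_upwards [h1, h2] with z hz1 hz2
    refine ⟨hz1, fun hzf => ?_⟩
    have := hz2 (hΩ.frontier_subset_closure_compl hzf)
    rw [inner_neg_right] at this
    linarith
  · obtain ⟨e, he, κ, hκ, -, r, hr, hcone, -⟩ := hΩ.exists_cone hy
    have hycl := frontier_subset_closure hy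
    have heν : inner ℝ e ν ≤ (0 : ℝ) := by
      refine inner_nonpos_of_eventually (A := closure Ω) (fun ε hε => (h ε hε).mono fun z hz => hz.1) ?_
      filter_upwards [Ioo_mem_nhdsGT hr] with t ht
      have := hcone y hycl (Metric.mem_ball_self hr) 0 (by simpa using hκ.le) t ht
      rw [add_zero] at this
      exact subset_closure this
    -- Moving from z to the frontier along e can enlarge the distance to y by the factor 1 + 1 / κ.
    have hε' : 0 < ε / (1 + 1 / κ) := by positivity
    obtain ⟨ρ, hρ, hball⟩ := Metric.eventually_nhds_iff.1 (h _ hε')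
    have hsmall : 0 < min (ρ / (1 + 1 / κ)) (r * κ) := by positivity
    filter_upwards [h ε hε, Metric.ball_mem_nhds y hsmall] with z hz1 hz2
    refine ⟨fun hzΩ => hz1.1 (subset_closure hzΩ), fun hzc => ?_⟩
    rw [mem_ball_iff_norm, lt_min_iff] at hz2
    have hzy : z ≠ y := fun e => hzc (e ▸ hycl)
    have hd : 0 < ‖z - y‖ := norm_pos_iff.2 (sub_ne_zero.2 hzy)
    set s₀ := ‖z - y‖ / κ
    have hs₀ : 0 < s₀ := by positivity
    have htop : z + s₀ • e ∈ Ω := by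
      have := hcone y hycl (Metric.mem_ball_self hr) (s₀⁻¹ • (z - y)) (by
        rw [norm_smul, norm_inv, Real.norm_eq_abs, abs_of_pos hs₀, inv_mul_eq_div,
          div_le_iff₀ hs₀]
        simp only [s₀]; exact le_of_eq (by field_simp)) s₀
        ⟨hs₀, by simp only [s₀]; rw [div_lt_iff₀ hκ]; exact hz2.2⟩
      rw [smul_add, smul_inv_smul₀ hs₀.ne'] at this
      convert this using 1
      abel
    obtain ⟨s, hs, hsf⟩ : ∃ s ∈ Icc 0 s₀, z + s • e ∈ frontier Ω := by
      by_contra hcon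
      push Not at hcon
      have hcont : Continuous fun s : ℝ => z + s • e := by fun_prop
      have hpre : IsPreconnected ((fun s : ℝ => z + s • e) '' Icc 0 s₀) :=
        isPreconnected_Icc.image _ hcont.continuousOn
      have hzm : z ∈ (fun s : ℝ => z + s • e) '' Icc 0 s₀ :=
        ⟨0, ⟨le_rfl, hs₀.le⟩, by simp⟩
      rcases isPreconnected_iff_subset_of_disjoint.1 hpre Ω (closure Ω)ᶜ hΩ.isOpen
        isClosed_closure.isOpen_compl (by
          rintro _ ⟨s, hs, rfl⟩
          by_contra hc
          rw [mem_union, not_or, notMem_compl_iff] at hc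
          refine hcon s hs ?_
          rw [hΩ.isOpen.frontier_eq]; exact ⟨hc.2, hc.1⟩) (by
          refine eq_empty_of_forall_notMem ?_
          rintro w ⟨-, hw1, hw2⟩
          exact hw2 (subset_closure hw1)) with h' | h'
      · exact hzc (subset_closure (h' hzm))
      · exact h' (mem_image_of_mem _ (right_mem_Icc.2 hs₀.le)) (subset_closure htop)
    have hn : ‖z + s • e - y‖ ≤ (1 + 1 / κ) * ‖z - y‖ := by
      rw [add_sub_right_comm]
      refine (norm_add_le _ _).trans ?_
      rw [norm_smul, he, mul_one, Real.norm_eq_abs, abs_of_nonneg hs.1]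
      have : (1 + 1 / κ) * ‖z - y‖ = ‖z - y‖ + s₀ := by simp only [s₀]; ring
      rw [this]; linarith [hs.2]
    have hlow := (hball (y := z + s • e) (by
      rw [dist_eq_norm]
      refine hn.trans_lt ?_
      rw [mul_comm]; exact (lt_div_iff₀ (by positivity)).1 hz2.1)).2 hsf
    have hup : ε / (1 + 1 / κ) * ‖z + s • e - y‖ ≤ ε * ‖z - y‖ := by
      calc ε / (1 + 1 / κ) * ‖z + s • e - y‖ ≤ ε / (1 + 1 / κ) * ((1 + 1 / κ) * ‖z - y‖) := by
            gcongr
        _ = ε * ‖z - y‖ := by field_simp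
    rw [add_sub_right_comm, inner_add_left, inner_smul_left, conj_trivial] at hlow
    rw [add_sub_right_comm] at hup
    nlinarith [mul_nonneg hs.1 (neg_nonneg.2 heν)]

/-- Transport of the outward normal by a bi-Lipschitz map of the domain whose inverse is
differentiable up to the boundary. -/
theorem IsOutwardNormal.transport {Ω : Set Plane} (hΩ : IsLipschitzDomain Ω)
    {Φ Θ : Plane → Plane} {L : ℝ≥0} (hΦ : LipschitzOnWith L Φ (closure Ω))
    (hΦm : MapsTo Φ (closure Ω) (closure Ω)) (hinv : InvOn Θ Φ (closure Ω) (closure Ω))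
    (hΘm : MapsTo Θ (closure Ω) (closure Ω)) (hΘf : MapsTo Θ (frontier Ω) (frontier Ω))
    {y ν : Plane} (hy : y ∈ frontier Ω) {D : Plane →L[ℝ] Plane}
    (hD : HasFDerivWithinAt Θ D (closure Ω) y) (hν : IsOutwardNormal Ω (Θ y) ν) :
    ContinuousLinearMap.adjoint D ν ≠ 0 ∧ IsOutwardNormal Ω y
      (‖ContinuousLinearMap.adjoint D ν‖⁻¹ • ContinuousLinearMap.adjoint D ν) := by
  have hycl := frontier_subset_closure hy
  obtain ⟨hν1, hν2⟩ := (hΩ.isOutwardNormal_iff (hΘf hy)).1 hν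
  set N := ContinuousLinearMap.adjoint D ν
  have hest : ∀ ε > 0, ∀ᶠ z in 𝓝[closure Ω] y,
      ‖Θ z - Θ y - D (z - y)‖ ≤ ε * ‖z - y‖ := fun ε hε => hD.isLittleO.def hε
  have hest' : ∀ ε > 0, ∀ᶠ z in 𝓝[closure Ω] y,
      |inner ℝ (Θ z - Θ y) ν - inner ℝ (z - y) N| ≤ ε * ‖z - y‖ := by
    intro ε hε
    filter_upwards [hest ε hε] with z hz
    have e : (inner ℝ (z - y) N : ℝ) = inner ℝ (D (z - y)) ν :=
      ContinuousLinearMap.adjoint_inner_right D (z - y) ν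
    rw [e, ← inner_sub_left]
    exact (abs_inner_le_norm_of_unit hν1 _).trans hz
  -- The point Θ y + t e has ν-component at most -κ t relative to Θ y, while its image under Φ stays
  -- within L t of y. If the adjoint killed ν, that component would be o(t).
  have hN : N ≠ 0 := by
    intro hN0
    obtain ⟨e, he, κ, hκ, -, r, hr, hcone, -⟩ := hΩ.exists_cone (hΘf hy)
    have hΘcl := frontier_subset_closure (hΘf hy)
    have hin : ∀ᶠ t in 𝓝[>] (0 : ℝ), Θ y + t • (e + κ • ν) ∈ closure Ω := by
      filter_upwards [Ioo_mem_nhdsGT hr] with t ht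
      exact subset_closure (hcone _ hΘcl (Metric.mem_ball_self hr) (κ • ν)
        (by rw [norm_smul, hν1, mul_one, Real.norm_eq_abs, abs_of_pos hκ]) t ht)
    have hin0 : ∀ᶠ t in 𝓝[>] (0 : ℝ), Θ y + t • e ∈ closure Ω := by
      filter_upwards [Ioo_mem_nhdsGT hr] with t ht
      have := hcone _ hΘcl (Metric.mem_ball_self hr) 0 (by simpa using hκ.le) t ht
      rw [add_zero] at this
      exact subset_closure this
    have heν := inner_nonpos_of_eventually (fun ε hε => (hν2 ε hε).mono fun z hz => hz.1) hin
    rw [inner_add_left, inner_smul_left, real_inner_self_eq_norm_sq, hν1, conj_trivial] at heν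
    have hlim : Tendsto (fun t : ℝ => Φ (Θ y + t • e)) (𝓝[>] 0) (𝓝[closure Ω] y) := by
      refine tendsto_nhdsWithin_iff.2 ⟨?_, hin0.mono fun t ht => hΦm ht⟩
      have h1 := (hΦ.continuousOn (Θ y) hΘcl).tendsto
      rw [hinv.2 hycl] at h1
      refine h1.comp (tendsto_nhdsWithin_iff.2 ⟨?_, hin0⟩)
      have : Continuous fun t : ℝ => Θ y + t • e := by fun_prop
      have := this.tendsto 0
      simp only [zero_smul, add_zero] at this
      exact this.mono_left nhdsWithin_le_nhds
    obtain ⟨t, ht1, ht2, ht3⟩ := ((hlim.eventually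
      (hest' (κ / (2 * (L + 1))) (by positivity))).and (hin0.and self_mem_nhdsWithin)).exists
    have ht0 : (0 : ℝ) < t := ht3
    have hl := hΦ.dist_le_mul _ ht2 _ hΘcl
    rw [hinv.2 hycl, dist_eq_norm, dist_eq_norm, add_sub_cancel_left, norm_smul, he, mul_one,
      Real.norm_eq_abs, abs_of_pos ht0] at hl
    rw [hN0, inner_zero_right, sub_zero, hinv.1 ht2, add_sub_cancel_left, inner_smul_left,
      conj_trivial] at ht1
    have h3 : κ / (2 * (L + 1)) * ‖Φ (Θ y + t • e) - y‖ ≤ κ / 2 * t := by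
      calc κ / (2 * (L + 1)) * ‖Φ (Θ y + t • e) - y‖ ≤ κ / (2 * (L + 1)) * (L * t) := by gcongr
        _ ≤ κ / (2 * (L + 1)) * ((L + 1) * t) := by gcongr; linarith
        _ = κ / 2 * t := by field_simp
    have h4 := (abs_le.1 (ht1.trans h3)).1
    nlinarith [mul_pos hκ ht0]
  refine ⟨hN, (hΩ.isOutwardNormal_iff hy).2 ⟨?_, fun ε hε => ?_⟩⟩
  · rw [norm_smul, norm_inv, norm_norm, inv_mul_cancel₀ (norm_ne_zero_iff.2 hN)]
  have hNn : 0 < ‖N‖ := norm_pos_iff.2 hN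
  have hε1 : 0 < ε * ‖N‖ / (‖D‖ + 2) := by positivity
  set ε₁ := ε * ‖N‖ / (‖D‖ + 2)
  have hΘc : Tendsto Θ (𝓝[closure Ω] y) (𝓝 (Θ y)) := hD.continuousWithinAt
  have hall : ∀ᶠ z in 𝓝[closure Ω] y, inner ℝ (z - y) N ≤ ε * ‖N‖ * ‖z - y‖ ∧
      (z ∈ frontier Ω → -(ε * ‖N‖ * ‖z - y‖) ≤ inner ℝ (z - y) N) := by
    filter_upwards [hest 1 one_pos, hest' ε₁ hε1, hΘc.eventually (hν2 ε₁ hε1),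
      self_mem_nhdsWithin] with z h1 h2 h3 hz
    have h4 : ‖Θ z - Θ y‖ ≤ (‖D‖ + 1) * ‖z - y‖ := by
      have := norm_add_le (Θ z - Θ y - D (z - y)) (D (z - y))
      rw [sub_add_cancel] at this
      linarith [D.le_opNorm (z - y)]
    have h5 : ε₁ * ‖Θ z - Θ y‖ ≤ ε₁ * ((‖D‖ + 1) * ‖z - y‖) := by gcongr
    have h6 : ε * ‖N‖ * ‖z - y‖ = ε₁ * ((‖D‖ + 1) * ‖z - y‖) + ε₁ * ‖z - y‖ := by
      simp only [ε₁]; field_simp; ring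
    rw [h6]
    have h7 := abs_le.1 h2
    refine ⟨?_, fun hzf => ?_⟩
    · have := h3.1 (hΘm hz)
      linarith
    · have := h3.2 (hΘf hzf)
      linarith
  filter_upwards [eventually_nhdsWithin_iff.1 hall] with z hz
  have hscale : (inner ℝ (z - y) (‖N‖⁻¹ • N) : ℝ) = inner ℝ (z - y) N / ‖N‖ := by
    rw [inner_smul_right, inv_mul_eq_div]
  rw [hscale]
  refine ⟨fun hzc => ?_, fun hzf => ?_⟩
  · rw [div_le_iff₀ hNn]
    linarith [(hz hzc).1]
  · rw [le_div_iff₀ hNn]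
    linarith [(hz (frontier_subset_closure hzf)).2 hzf]

namespace IsDomainDiffeo

variable {Ω : Set Plane} {Φ : Plane → Plane}

theorem bijOn_frontier (hΦ : IsDomainDiffeo Ω Φ) (hΩ : IsOpen Ω) :
    BijOn Φ (frontier Ω) (frontier Ω) := by
  rw [hΩ.frontier_eq]
  refine ⟨fun x hx => ⟨hΦ.bijOn_closure.mapsTo hx.1, fun hxΩ => ?_⟩,
    hΦ.bijOn_closure.injOn.mono sdiff_subset, fun y hy => ?_⟩
  · obtain ⟨z, hz, hzx⟩ := hΦ.bijOn.surjOn hxΩ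
    rw [hΦ.bijOn_closure.injOn (subset_closure hz) hx.1 hzx] at hz
    exact hx.2 hz
  · obtain ⟨x, hx, rfl⟩ := hΦ.bijOn_closure.surjOn hy.1
    exact ⟨x, ⟨hx, fun hxP => hy.2 (hΦ.bijOn.mapsTo hxP)⟩, rfl⟩

/-- Contrapositive: a continuous normal field near p is transported by the adjoint derivative of Θ,
which is continuous up to the boundary, to a continuous normal field near Φ p. -/
theorem mem_angularPoints (hΦ : IsDomainDiffeo Ω Φ) (hΩ : IsLipschitzDomain Ω)
    (hc : IsCompact (closure Ω)) {p : Plane} (hp : p ∈ frontier Ω)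
    (hΦp : Φ p ∈ angularPoints Ω) : p ∈ angularPoints Ω := by
  refine ⟨hp, ?_⟩
  rintro ⟨n, U, hU, hnc, hn⟩
  refine hΦp.2 ?_
  obtain ⟨Θ, hΘ, hinv⟩ := hΦ.contDiffOn_inverse
  obtain ⟨L, hL⟩ := hΩ.exists_lipschitzOnWith hc hΦ.contDiffOn
  have hΘcl : BijOn Θ (closure Ω) (closure Ω) := hΦ.bijOn_closure.symm hinv.symm
  have hΘfr : BijOn Θ (frontier Ω) (frontier Ω) :=
    (hΦ.bijOn_frontier hΩ.isOpen).symm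
      (hinv.symm.mono frontier_subset_closure frontier_subset_closure)
  have hpcl := frontier_subset_closure hp
  have hxcl := frontier_subset_closure hΦp.1
  obtain ⟨ρ, hρ, f', hf'c, hf'⟩ := (hΘ _ hxcl).exists_hasFDerivWithinAt_ball hxcl
  have hUn : Θ ⁻¹' U ∈ 𝓝[closure Ω] (Φ p) := by
    have := (hΘ.continuousOn (Φ p) hxcl).tendsto
    rw [hinv.1 hpcl] at this
    exact this hU
  obtain ⟨ρ', hρ', hball⟩ := Metric.mem_nhdsWithin_iff.1 hUn
  set R := min ρ ρ'
  have hsub : ∀ y ∈ frontier Ω ∩ Metric.ball (Φ p) R,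
      y ∈ closure Ω ∩ Metric.ball (Φ p) ρ ∧ Θ y ∈ frontier Ω ∩ U := fun y hy =>
    ⟨⟨frontier_subset_closure hy.1, Metric.ball_subset_ball (min_le_left _ _) hy.2⟩,
      hΘfr.mapsTo hy.1, hball ⟨Metric.ball_subset_ball (min_le_right _ _) hy.2,
        frontier_subset_closure hy.1⟩⟩
  let N : Plane → Plane := fun y => ContinuousLinearMap.adjoint (f' y) (n (Θ y))
  have htr : ∀ y ∈ frontier Ω ∩ Metric.ball (Φ p) R,
      N y ≠ 0 ∧ IsOutwardNormal Ω y (‖N y‖⁻¹ • N y) := fun y hy =>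
    IsOutwardNormal.transport hΩ hL hΦ.bijOn_closure.mapsTo hinv hΘcl.mapsTo hΘfr.mapsTo hy.1
      (hf' y (hsub y hy).1) (hn _ (hsub y hy).2)
  refine ⟨fun y => ‖N y‖⁻¹ • N y, Metric.ball (Φ p) R,
    Metric.ball_mem_nhds _ (lt_min hρ hρ'), ?_, fun y hy => (htr y hy).2⟩
  have hNc : ContinuousOn N (frontier Ω ∩ Metric.ball (Φ p) R) := by
    have h1 : ContinuousOn (fun y => n (Θ y)) (frontier Ω ∩ Metric.ball (Φ p) R) :=
      hnc.comp (hΘ.continuousOn.mono fun y hy => (hsub y hy).1.1) fun y hy => (hsub y hy).2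
    have h2 : ContinuousOn (fun y => ContinuousLinearMap.adjoint (f' y))
        (frontier Ω ∩ Metric.ball (Φ p) R) :=
      ContinuousLinearMap.adjoint.continuous.comp_continuousOn
        (hf'c.mono fun y hy => (hsub y hy).1)
    exact h2.clm_apply h1
  exact (hNc.norm.inv₀ fun y hy => norm_ne_zero_iff.2 (htr y hy).1).smul hNc

end IsDomainDiffeo

/-! ### The boundary distance -/

/-- An affine reparametrization of the subarc between s and t is again admissible, with speed
multiplied by |t - s| ≤ 1. -/
theorem boundaryDist_le_of_mem_boundaryCurves {Ω : Set Plane} {x y : Plane} {γ : ℝ → Plane}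
    (hγ : γ ∈ boundaryCurves Ω x y) {s t : ℝ} (hs : s ∈ Icc (0 : ℝ) 1) (ht : t ∈ Icc (0 : ℝ) 1) :
    boundaryDist Ω (γ s) (γ t) ≤
      ENNReal.ofReal (∫ τ in (0 : ℝ)..1, ‖derivWithin γ (Icc 0 1) τ‖) := by
  obtain ⟨hC, hfr, -, -, c, hc⟩ := hγ
  let σ : ℝ → ℝ := fun τ => s + τ * (t - s)
  have hσ : MapsTo σ (Icc 0 1) (Icc 0 1) := by
    intro τ hτ
    have : σ τ = (1 - τ) * s + τ * t := by simp only [σ]; ring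
    rw [this]
    exact ⟨add_nonneg (mul_nonneg (by linarith [hτ.2]) hs.1) (mul_nonneg hτ.1 ht.1),
      by nlinarith [hs.2, ht.2, hτ.1, hτ.2]⟩
  have hder : ∀ τ ∈ Icc (0 : ℝ) 1, derivWithin (γ ∘ σ) (Icc 0 1) τ =
      (t - s) • derivWithin γ (Icc 0 1) (σ τ) := by
    intro τ hτ
    have h1 : HasDerivWithinAt γ (derivWithin γ (Icc 0 1) (σ τ)) (Icc 0 1) (σ τ) :=
      (hC.differentiableOn one_ne_zero (σ τ) (hσ hτ)).hasDerivWithinAt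
    have h2 : HasDerivWithinAt σ (t - s) (Icc 0 1) τ := by
      have := (((hasDerivAt_id τ).mul_const (t - s)).const_add s).hasDerivWithinAt (s := Icc 0 1)
      rwa [one_mul] at this
    exact (h1.scomp τ h2 hσ).derivWithin (uniqueDiffOn_Icc zero_lt_one τ hτ)
  have hnorm : ∀ τ ∈ Icc (0 : ℝ) 1, ‖derivWithin (γ ∘ σ) (Icc 0 1) τ‖ = |t - s| * c := by
    intro τ hτ
    rw [hder τ hτ, norm_smul, hc _ (hσ hτ), Real.norm_eq_abs]
  have hmem : γ ∘ σ ∈ boundaryCurves Ω (γ s) (γ t) := by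
    refine ⟨hC.comp (ContDiff.contDiffOn (by fun_prop)) hσ, fun τ hτ => hfr _ (hσ hτ), ?_, ?_,
      _, hnorm⟩
    · simp [σ]
    · simp [σ]
  refine (iInf₂_le _ hmem).trans (ENNReal.ofReal_le_ofReal ?_)
  have hint : ∀ (f : ℝ → ℝ) (k : ℝ), (∀ τ ∈ Icc (0 : ℝ) 1, f τ = k) →
      ∫ τ in (0 : ℝ)..1, f τ = k := by
    intro f k hf
    have : ∫ τ in (0 : ℝ)..1, f τ = ∫ _ in (0 : ℝ)..1, k :=
      intervalIntegral.integral_congr (by rw [uIcc_of_le zero_le_one]; exact hf)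
    simp [this]
  rw [hint _ _ hnorm, hint _ _ hc]
  have hc0 : 0 ≤ c := by rw [← hc 0 (by simp)]; exact norm_nonneg _
  have : |t - s| ≤ 1 := abs_le.2 ⟨by linarith [hs.2, ht.1], by linarith [hs.1, ht.2]⟩
  nlinarith

/-- Two boundary points at distance less than `C` lie in a connected part of the boundary whose
points are at mutual distance less than `C`. -/
theorem exists_isPreconnected_of_boundaryDist_lt {Ω : Set Plane} {x y : Plane} {C : ℝ≥0∞}
    (h : boundaryDist Ω x y < C) :
    ∃ T : Set Plane, IsPreconnected T ∧ T ⊆ frontier Ω ∧ x ∈ T ∧ y ∈ T ∧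
      ∀ a ∈ T, ∀ b ∈ T, boundaryDist Ω a b < C := by
  simp only [boundaryDist, iInf_lt_iff] at h
  obtain ⟨γ, hγ, hlt⟩ := h
  refine ⟨γ '' Icc 0 1, isPreconnected_Icc.image _ hγ.1.continuousOn, ?_,
    ⟨0, by simp, hγ.2.2.1⟩, ⟨1, by simp, hγ.2.2.2.1⟩, ?_⟩
  · rintro _ ⟨t, ht, rfl⟩
    exact hγ.2.1 t ht
  · rintro _ ⟨s, hs, rfl⟩ _ ⟨t, ht, rfl⟩
    exact (boundaryDist_le_of_mem_boundaryCurves hγ hs ht).trans_lt hlt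

theorem deformationBound_le_of_vertices {Ω P₁ P₂ : Set Plane} {x y : Plane}
    (hx : x ∈ polytopeVertices P₁) (hy : y ∈ polytopeVertices P₁) (hxy : x ≠ y) :
    deformationBound Ω P₁ P₂ ≤ boundaryDist Ω x y :=
  (min_le_right _ _).trans ((min_le_left _ _).trans
    ((iInf₂_le x hx).trans ((iInf₂_le y hy).trans (iInf_le _ hxy))))

theorem deformationBound_le_of_fictitious {Ω P₁ P₂ : Set Plane} {x y : Plane}
    (hx : x ∈ fictitiousVertices Ω P₁) (hy : y ∈ fictitiousVertices Ω P₂) :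
    deformationBound Ω P₁ P₂ ≤ boundaryDist Ω x y :=
  (min_le_left _ _).trans ((iInf₂_le x hx).trans (iInf₂_le y hy))

/-! ### Deformations of the boundary of a polytope -/

theorem lineMap_image_openSegment (a b : Plane) {s t : ℝ} (h : s < t) :
    openSegment ℝ (AffineMap.lineMap a b s : Plane) (AffineMap.lineMap a b t) =
      AffineMap.lineMap a b '' Ioo s t := by
  rw [← openSegment_eq_Ioo h, image_openSegment]

theorem lineMap_image_segment (a b : Plane) {s t : ℝ} (h : s ≤ t) :
    segment ℝ (AffineMap.lineMap a b s : Plane) (AffineMap.lineMap a b t) =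
      AffineMap.lineMap a b '' Icc s t := by
  rw [← segment_eq_Icc h, image_segment]

namespace IsPolytopeEdge

variable {P : Set Plane} {a b : Plane}

theorem segment_subset (he : IsPolytopeEdge P a b) : segment ℝ a b ⊆ frontier P := by
  rw [← insert_endpoints_openSegment]
  exact insert_subset (polytopeVertices_subset_frontier P he.left_mem)
    (insert_subset (polytopeVertices_subset_frontier P he.right_mem)
      fun z hz => (he.subset hz).1)

theorem endpoint_mem_of_isPreconnected (he : IsPolytopeEdge P a b) {T : Set Plane}
    (hT : IsPreconnected T) (hTF : T ⊆ frontier P) {y z : Plane} (hy : y ∈ T)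
    (hyab : y ∈ openSegment ℝ a b) (hz : z ∈ T) (hzab : z ∉ openSegment ℝ a b) :
    a ∈ T ∨ b ∈ T := by
  by_contra hcon
  push Not at hcon
  exact hzab (he.subset_of_isPreconnected hT hTF hcon.1 hcon.2 hy hyab hz)

/-- A connected part of the boundary which joins the end point `a` to a point of the edge and
avoids the end point `b` contains the segment between them. -/
theorem mem_of_isPreconnected (he : IsPolytopeEdge P a b) {T : Set Plane}
    (hT : IsPreconnected T) (hTF : T ⊆ frontier P) (ha : a ∈ T) (hb : b ∉ T) {s t : ℝ}
    (hs : 0 ≤ s) (hst : s ≤ t) (ht : t < 1) (htT : AffineMap.lineMap a b t ∈ T) :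
    AffineMap.lineMap a b s ∈ T := by
  rcases hs.eq_or_lt with rfl | hs
  · simpa using ha
  rcases hst.eq_or_lt with rfl | hst
  · exact htT
  by_contra hcon
  have hinj := AffineMap.lineMap_injective ℝ he.ne
  have hseg : openSegment ℝ (AffineMap.lineMap a b s : Plane) b =
      AffineMap.lineMap a b '' Ioo s 1 := by
    rw [← lineMap_image_openSegment a b (hst.trans ht), AffineMap.lineMap_apply_one]
  have hclosed := isClosed_segment_plane (AffineMap.lineMap a b (0 : ℝ)) (AffineMap.lineMap a b s)
  have hopen : ∀ y ∈ openSegment ℝ (AffineMap.lineMap a b s : Plane) b,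
      ∀ᶠ z in 𝓝 y, z ∈ frontier P → z ∈ openSegment ℝ (AffineMap.lineMap a b s : Plane) b := by
    rw [hseg]
    rintro _ ⟨τ, hτ, rfl⟩
    have hmem : AffineMap.lineMap a b τ ∈ openSegment ℝ a b := by
      rw [openSegment_eq_image_lineMap]
      exact mem_image_of_mem _ ⟨hs.trans hτ.1, hτ.2⟩
    have hnot : AffineMap.lineMap a b τ ∉
        segment ℝ (AffineMap.lineMap a b (0 : ℝ) : Plane) (AffineMap.lineMap a b s) := by
      rw [lineMap_image_segment a b hs.le]
      rintro ⟨θ, hθ, hθτ⟩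
      rw [hinj hθτ] at hθ
      exact not_lt.2 hθ.2 hτ.1
    filter_upwards [he.eventually_mem _ hmem, hclosed.isOpen_compl.mem_nhds hnot]
      with z hz1 hz2 hzP
    have hz := hz1 hzP
    rw [openSegment_eq_image_lineMap] at hz
    obtain ⟨θ, hθ, rfl⟩ := hz
    refine mem_image_of_mem _ ⟨?_, hθ.2⟩
    by_contra hc
    refine hz2 ?_
    rw [lineMap_image_segment a b hs.le]
    exact mem_image_of_mem _ ⟨hθ.1.le, not_lt.1 hc⟩
  have hsub := hT.subset_openSegment hopen hTF hcon hb htT (by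
    rw [hseg]; exact mem_image_of_mem _ ⟨hst, ht⟩)
  have ha' := hsub ha
  rw [hseg] at ha'
  obtain ⟨θ, hθ, hθa⟩ := ha'
  rw [← AffineMap.lineMap_apply_zero (k := ℝ) a b] at hθa
  have h0 : θ = 0 := hinj (by simpa using hθa)
  linarith [hθ.1]

end IsPolytopeEdge

/-- A homeomorphism of the boundary which moves every point within a connected set containing at
most one vertex does not exchange the order of the preimages of the end points of an edge. -/
theorem IsPolytopalModel.not_crossing {Ω P : Set Plane} {Ψ : Plane → Plane}
    (h : IsPolytopalModel Ω P Ψ) (hΩ : IsLipschitzDomain Ω) {g : Plane → Plane}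
    (hg : ContinuousOn g (frontier P)) (hgi : InjOn g (frontier P))
    (hgm : MapsTo g (frontier P) (frontier P))
    (hT : ∀ x ∈ frontier P, ∃ T, IsPreconnected T ∧ T ⊆ frontier P ∧ x ∈ T ∧ g x ∈ T ∧
      ∀ v ∈ polytopeVertices P, ∀ w ∈ polytopeVertices P, v ∈ T → w ∈ T → v = w)
    {a b : Plane} (he : IsPolytopeEdge P a b) {s t : ℝ} (hs : 0 < s) (hst : s < t) (ht : t < 1)
    (hgs : g (AffineMap.lineMap a b s) = b) (hgt : g (AffineMap.lineMap a b t) = a) : False := by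
  set l : ℝ → Plane := fun r => AffineMap.lineMap a b r
  have hlinj : Function.Injective l := AffineMap.lineMap_injective ℝ he.ne
  have hlc : Continuous l := AffineMap.lineMap_continuous
  have hl0 : l 0 = a := AffineMap.lineMap_apply_zero a b
  have hl1 : l 1 = b := AffineMap.lineMap_apply_one a b
  have hlopen : ∀ r ∈ Ioo (0 : ℝ) 1, l r ∈ openSegment ℝ a b := fun r hr => by
    rw [openSegment_eq_image_lineMap]; exact mem_image_of_mem _ hr
  have hlF : ∀ r ∈ Icc (0 : ℝ) 1, l r ∈ frontier P := fun r hr => by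
    refine he.segment_subset ?_
    rw [segment_eq_image_lineMap]; exact mem_image_of_mem _ hr
  have hsI : s ∈ Icc (0 : ℝ) 1 := ⟨hs.le, by linarith⟩
  have htI : t ∈ Icc (0 : ℝ) 1 := ⟨by linarith, ht.le⟩
  have hinj : ∀ r ∈ Icc (0 : ℝ) 1, ∀ r' ∈ Icc (0 : ℝ) 1, g (l r) = g (l r') → r = r' :=
    fun r hr r' hr' e => hlinj (hgi (hlF r hr) (hlF r' hr') e)
  have hgl : ContinuousOn (g ∘ l) (Icc 0 1) := hg.comp hlc.continuousOn hlF
  -- no vertex in the image of the edge, apart from its end points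
  have hnv : ∀ r ∈ Ico (0 : ℝ) 1, r ≠ s → r ≠ t → g (l r) ∉ polytopeVertices P := by
    intro r hr hrs hrt hv
    have hrI : r ∈ Icc (0 : ℝ) 1 := ⟨hr.1, hr.2.le⟩
    obtain ⟨T, hTc, hTF, hx, hgx, hTV⟩ := hT (l r) (hlF r hrI)
    have hends : g (l r) = a ∨ g (l r) = b := by
      rcases hr.1.eq_or_lt with h0 | h0
      · left
        rw [← h0, hl0] at hx hv hgx ⊢
        exact hTV _ hv _ he.left_mem hgx hx
      · rcases he.endpoint_mem_of_isPreconnected hTc hTF hx (hlopen r ⟨h0, hr.2⟩) hgx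
          (fun hc => (he.subset hc).2 hv) with hm | hm
        · exact Or.inl (hTV _ hv _ he.left_mem hgx hm)
        · exact Or.inr (hTV _ hv _ he.right_mem hgx hm)
    rcases hends with e | e
    · exact hrt (hinj r hrI t htI (e.trans hgt.symm))
    · exact hrs (hinj r hrI s hsI (e.trans hgs.symm))
  have himage : ∀ J : Set ℝ, IsPreconnected J → J ⊆ Ico 0 1 → s ∉ J → t ∉ J → J.Nonempty →
      ∃ a' b', IsPolytopeEdge P a' b' ∧ (g ∘ l) '' J ⊆ openSegment ℝ a' b' ∧
        ∀ v ∈ polytopeVertices P, v ∈ closure ((g ∘ l) '' J) → v = a' ∨ v = b' := by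
    intro J hJ hJ1 hJs hJt hne
    have hJI : J ⊆ Icc 0 1 := hJ1.trans Ico_subset_Icc_self
    refine h.exists_edge_of_isPreconnected hΩ (hJ.image _ (hgl.mono hJI)) ?_ (hne.image _)
    rintro _ ⟨r, hr, rfl⟩
    exact ⟨hgm (hlF r (hJI hr)), hnv r (hJ1 hr) (fun e => hJs (e ▸ hr)) (fun e => hJt (e ▸ hr))⟩
  have hcl : ∀ J : Set ℝ, J ⊆ Icc 0 1 → ∀ r ∈ Icc (0 : ℝ) 1, r ∈ closure J →
      g (l r) ∈ closure ((g ∘ l) '' J) := fun J hJ r hr hrJ =>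
    ContinuousWithinAt.mem_closure_image ((hgl r hr).mono hJ) hrJ
  have hpair : ∀ a' b' : Plane, (a = a' ∨ a = b') → (b = a' ∨ b = b') →
      openSegment ℝ a' b' = openSegment ℝ a b := by
    rintro a' b' (rfl | rfl) (rfl | rfl)
    · exact absurd rfl he.ne
    · rfl
    · exact openSegment_symm ℝ _ _
    · exact absurd rfl he.ne
  have hI1 : Ico 0 s ⊆ Icc (0 : ℝ) 1 := fun r hr => ⟨hr.1, by linarith [hr.2]⟩
  have hI2 : Ioo s t ⊆ Icc (0 : ℝ) 1 := fun r hr => ⟨by linarith [hr.1], by linarith [hr.2]⟩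
  -- The image of [0, s) has no vertex, so it stays in one edge. That edge ends at b, the limit at
  -- s, and at a, because a is joined to g a through a set with no other vertex.
  have hga : g a ∈ openSegment ℝ a b := by
    obtain ⟨a', b', he', hsub, hends⟩ := himage (Ico 0 s) isPreconnected_Ico
      (fun r hr => ⟨hr.1, by linarith [hr.2]⟩) (fun hc => lt_irrefl _ hc.2)
      (fun hc => by linarith [hc.2]) ⟨0, le_rfl, hs⟩
    have hga' : g a ∈ openSegment ℝ a' b' := hsub ⟨0, ⟨le_rfl, hs⟩, by simp [hl0]⟩
    have hb := hends b he.right_mem (by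
      rw [← hgs]
      exact hcl _ hI1 s hsI (by rw [closure_Ico hs.ne]; exact right_mem_Icc.2 hs.le))
    obtain ⟨T, hTc, hTF, hx, hgx, hTV⟩ := hT a (polytopeVertices_subset_frontier P he.left_mem)
    have ha : a = a' ∨ a = b' := by
      rcases he'.endpoint_mem_of_isPreconnected hTc hTF hgx hga' hx
        (fun hc => (he'.subset hc).2 he.left_mem) with hm | hm
      · exact Or.inl (hTV _ he.left_mem _ he'.left_mem hx hm)
      · exact Or.inr (hTV _ he.left_mem _ he'.right_mem hx hm)
    rwa [hpair a' b' ha hb] at hga'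
  have hmid : (g ∘ l) '' Ioo s t ⊆ openSegment ℝ a b := by
    obtain ⟨a', b', he', hsub, hends⟩ := himage (Ioo s t) isPreconnected_Ioo
      (fun r hr => ⟨by linarith [hr.1], by linarith [hr.2]⟩) (fun hc => lt_irrefl _ hc.1)
      (fun hc => lt_irrefl _ hc.2) (nonempty_Ioo.2 hst)
    have hb := hends b he.right_mem (by
      rw [← hgs]
      exact hcl _ hI2 s hsI (by rw [closure_Ioo hst.ne]; exact left_mem_Icc.2 hst.le))
    have ha := hends a he.left_mem (by
      rw [← hgt]
      exact hcl _ hI2 t htI (by rw [closure_Ioo hst.ne]; exact right_mem_Icc.2 hst.le))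
    rwa [hpair a' b' ha hb] at hsub
  have hd : b - a ≠ 0 := sub_ne_zero.2 he.ne.symm
  let k : Plane → ℝ := fun y => inner ℝ (y - a) (b - a) / ‖b - a‖ ^ 2
  have hk : ∀ r : ℝ, k (l r) = r := by
    intro r
    simp only [k, l, AffineMap.lineMap_apply, vsub_eq_sub, vadd_eq_add, add_sub_cancel_right,
      inner_smul_left, real_inner_self_eq_norm_sq, conj_trivial]
    rw [mul_div_cancel_right₀]
    exact pow_ne_zero 2 (norm_ne_zero_iff.2 hd)
  have hkc : Continuous k := by fun_prop
  rw [openSegment_eq_image_lineMap] at hga hmid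
  obtain ⟨θ, hθ, hθa⟩ := hga
  -- From s to t the image runs along the edge from b back to a, so it passes through g a again,
  -- against injectivity.
  have hivt := intermediate_value_Icc' (f := k ∘ g ∘ l) hst.le
    (hkc.comp_continuousOn (hgl.mono fun r hr => ⟨by linarith [hr.1], by linarith [hr.2]⟩))
  have e1 : (k ∘ g ∘ l) s = 1 := by
    have : g (l s) = l 1 := hgs.trans hl1.symm
    simp [this, hk]
  have e2 : (k ∘ g ∘ l) t = 0 := by
    have : g (l t) = l 0 := hgt.trans hl0.symm
    simp [this, hk]
  rw [e1, e2] at hivt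
  obtain ⟨r, hr, hrθ⟩ := hivt ⟨hθ.1.le, hθ.2.le⟩
  have hrs : r ≠ s := by rintro rfl; rw [e1] at hrθ; linarith [hθ.2]
  have hrt : r ≠ t := by rintro rfl; rw [e2] at hrθ; linarith [hθ.1]
  have hrI : r ∈ Ioo s t := ⟨lt_of_le_of_ne hr.1 hrs.symm, lt_of_le_of_ne hr.2 hrt⟩
  obtain ⟨θ', -, hθ'⟩ := hmid (mem_image_of_mem _ hrI)
  have hθθ : θ' = θ := by
    rw [← hrθ]
    change θ' = k ((g ∘ l) r)
    rw [← hθ']; exact (hk θ').symm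
  have hfin : g (l r) = g (l 0) := by
    rw [hl0, ← hθa, ← hθθ]; exact hθ'.symm
  have := hinj r (hI2 hrI) 0 (by simp) hfin
  linarith [hrI.1]

/-! ### Displacements of a polytope -/

namespace IsPolytopalModel

variable {Ω P : Set Plane} {Ψ A : Plane → Plane}

/-- The conjugate of A by Ψ fixes the vertices, hence preserves every edge: on an edge both x and
its image lie on the same line. -/
theorem isTangentialDisplacement (h : IsPolytopalModel Ω P Ψ) (hΩ : IsLipschitzDomain Ω)
    (hAc : ContinuousOn A (closure Ω)) (hA : BijOn A Ω Ω) (hA' : BijOn A (closure Ω) (closure Ω))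
    (hV : ∀ v ∈ polytopeVertices P, A v = v) :
    IsTangentialDisplacement P fun x => modelInverse P Ψ (A (Ψ x)) - x := by
  let g : Plane → Plane := fun x => modelInverse P Ψ (A (Ψ x))
  have hfun : (fun x => x + (modelInverse P Ψ (A (Ψ x)) - x)) = g := by
    funext x; simp [g]
  have hgc : ContinuousOn g (closure P) :=
    h.continuousOn_inverse.comp (hAc.comp h.continuousOn h.bijOn_closure.mapsTo)
      (hA'.mapsTo.comp h.bijOn_closure.mapsTo)
  have hgP : BijOn g P P := h.bijOn_inverse.comp (hA.comp h.bijOn)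
  have hgP' : BijOn g (closure P) (closure P) :=
    h.bijOn_inverse_closure.comp (hA'.comp h.bijOn_closure)
  have hgV : ∀ v ∈ polytopeVertices P, g v = v := fun v hv => by
    have hvP := frontier_subset_closure (polytopeVertices_subset_frontier P hv)
    have := h.invOn.1 hvP
    rw [h.eq_on_vertices v hv] at this
    simp only [g, h.eq_on_vertices v hv, hV v hv, this]
  have hgF : MapsTo g (frontier P) (frontier P) := by
    rw [h.regular.1.isOpen.frontier_eq]
    rintro x ⟨hx, hxP⟩
    refine ⟨hgP'.mapsTo hx, fun hgx => ?_⟩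
    obtain ⟨z, hz, hzx⟩ := hgP.surjOn hgx
    rw [hgP'.injOn (subset_closure hz) hx hzx] at hz
    exact hxP hz
  refine ⟨hgc.sub continuousOn_id, by rw [hfun]; exact hgP, by rw [hfun]; exact hgP',
    fun x hx ν hν => ?_⟩
  change inner ℝ (g x - x) ν = 0
  by_cases hxV : x ∈ polytopeVertices P
  · rw [hgV x hxV, sub_self, inner_zero_left]
  obtain ⟨a, b, he, hxab⟩ := h.exists_edge hΩ hx hxV
  have hgx := h.mapsTo_edge hΩ (hgc.mono frontier_subset_closure)
    (hgP'.injOn.mono frontier_subset_closure) hgF hgV he hxab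
  rw [openSegment_eq_image_lineMap] at hxab hgx
  obtain ⟨s, hs, rfl⟩ := hxab
  obtain ⟨t, -, hgt⟩ := hgx
  -- Both directions of the edge stay in the closure of P for small times, so the normal is
  -- orthogonal to the edge.
  have hdir : ∀ σ : ℝ, inner ℝ (σ • (b - a)) ν ≤ (0 : ℝ) := by
    intro σ
    refine inner_nonpos_of_eventually (A := closure P) (y := AffineMap.lineMap a b s)
      (fun ε hε => eventually_closure_of_eventually ((hν.2 ε hε).mono fun z hz => hz.1)) ?_
    have hc : Tendsto (fun τ : ℝ => s + τ * σ) (𝓝[>] 0) (𝓝 s) := by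
      have : Continuous fun τ : ℝ => s + τ * σ := by fun_prop
      have := this.tendsto 0
      simp only [zero_mul, add_zero] at this
      exact this.mono_left nhdsWithin_le_nhds
    filter_upwards [hc.eventually (Ioo_mem_nhds hs.1 hs.2)] with τ hτ
    refine frontier_subset_closure (he.subset ?_).1
    rw [openSegment_eq_image_lineMap]
    refine ⟨_, hτ, ?_⟩
    simp only [AffineMap.lineMap_apply, vsub_eq_sub, vadd_eq_add]
    module
  have h0 : inner ℝ (b - a) ν = (0 : ℝ) := by
    have h1 := hdir 1
    have h2 := hdir (-1)
    rw [one_smul] at h1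
    rw [neg_smul, one_smul, inner_neg_left] at h2
    linarith
  have hdiff : g (AffineMap.lineMap a b s) - AffineMap.lineMap a b s = (t - s) • (b - a) := by
    rw [← hgt]
    simp only [AffineMap.lineMap_apply, vsub_eq_sub, vadd_eq_add]
    module
  rw [hdiff, inner_smul_left, h0, mul_zero]

theorem exists_lipschitzOnWith_displacement (h : IsPolytopalModel Ω P Ψ)
    (hA : ∃ K, LipschitzOnWith K A (closure Ω)) (hA' : MapsTo A (closure Ω) (closure Ω))
    (hi : ∃ K : ℝ≥0, LipschitzOnWith K (modelInverse P Ψ) (closure Ω)) :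
    ∃ K : ℝ≥0, LipschitzOnWith K (fun x => modelInverse P Ψ (A (Ψ x)) - x) (closure P) := by
  obtain ⟨K, hK⟩ := hA
  obtain ⟨L, hL⟩ := hi
  obtain ⟨M, hM⟩ := h.lipschitz
  exact ⟨_, (hL.comp (hK.comp hM h.bijOn_closure.mapsTo)
    (hA'.comp h.bijOn_closure.mapsTo)).sub LipschitzWith.id.lipschitzOnWith⟩

end IsPolytopalModel

/-! ### Moving the preimages of the vertices -/

section vertices

variable {Ω P₁ P₂ : Set Plane} {Ψ₁ Ψ₂ Φ Θ : Plane → Plane}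

/-- Every boundary point `x` is joined to `Φ x` by a connected part of the boundary whose points
are at mutual distance less than the deformation bound. -/
theorem exists_isPreconnected_of_deformationBound
    (hC : ∀ x ∈ frontier Ω, boundaryDist Ω x (Φ x) < deformationBound Ω P₁ P₂)
    {x : Plane} (hx : x ∈ frontier Ω) :
    ∃ T : Set Plane, IsPreconnected T ∧ T ⊆ frontier Ω ∧ x ∈ T ∧ Φ x ∈ T ∧
      (∀ v ∈ polytopeVertices P₁, ∀ w ∈ polytopeVertices P₁, v ∈ T → w ∈ T → v = w) ∧
      ∀ v ∈ fictitiousVertices Ω P₁, ∀ w ∈ fictitiousVertices Ω P₂, v ∈ T → w ∉ T := by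
  obtain ⟨T, hT, hTF, h1, h2, hd⟩ := exists_isPreconnected_of_boundaryDist_lt (hC x hx)
  refine ⟨T, hT, hTF, h1, h2, fun v hv w hw hvT hwT => ?_, fun v hv w hw hvT hwT => ?_⟩
  · by_contra hne
    exact not_le.2 (hd v hvT w hwT) (deformationBound_le_of_vertices hv hw hne)
  · exact not_le.2 (hd v hvT w hwT) (deformationBound_le_of_fictitious hv hw)

/-- Both v and Θ v are angular, hence vertices of P₁, and a connected set containing at most one
vertex of P₁ contains them both. -/
theorem apply_angular_eq (hΩ : IsLipschitzDomain Ω) (h₁ : IsPolytopalModel Ω P₁ Ψ₁)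
    (hΦ : IsDomainDiffeo Ω Φ) (hinv : InvOn Θ Φ (closure Ω) (closure Ω))
    (hC : ∀ x ∈ frontier Ω, boundaryDist Ω x (Φ x) < deformationBound Ω P₁ P₂)
    {v : Plane} (hv : v ∈ angularPoints Ω) : Θ v = v := by
  have hvcl := frontier_subset_closure hv.1
  have hΘ : Θ v ∈ frontier Ω := ((hΦ.bijOn_frontier hΩ.isOpen).symm (hinv.symm.mono
    frontier_subset_closure frontier_subset_closure)).mapsTo hv.1
  have hang : Θ v ∈ angularPoints Ω :=
    hΦ.mem_angularPoints hΩ h₁.isCompact_closure_domain hΘ (by rwa [hinv.2 hvcl])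
  obtain ⟨T, -, -, h1, h2, h3, -⟩ := exists_isPreconnected_of_deformationBound hC hΘ
  rw [hinv.2 hvcl] at h2
  exact h3 _ (h₁.angular_subset hang) _ (h₁.angular_subset hv) h1 h2

/-- A fictitious vertex of `P₁` is joined to its preimage by a connected part of the boundary
which avoids the vertices of `P₂`, the other vertices of `P₁` and their preimages. -/
theorem exists_isPreconnected_to_vertex (hΩ : IsLipschitzDomain Ω)
    (h₁ : IsPolytopalModel Ω P₁ Ψ₁)
    (hΦ : IsDomainDiffeo Ω Φ) (hinv : InvOn Θ Φ (closure Ω) (closure Ω))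
    (hC : ∀ x ∈ frontier Ω, boundaryDist Ω x (Φ x) < deformationBound Ω P₁ P₂)
    {v : Plane} (hv : v ∈ fictitiousVertices Ω P₁) :
    ∃ K : Set Plane, IsPreconnected K ∧ K ⊆ frontier Ω ∧ Θ v ∈ K ∧ v ∈ K ∧
      Disjoint K (polytopeVertices P₂) ∧
      ∀ w ∈ polytopeVertices P₁, w ≠ v → w ∉ K ∧ Θ w ∉ K := by
  have hΦf := hΦ.bijOn_frontier hΩ.isOpen
  have hinvf : InvOn Θ Φ (frontier Ω) (frontier Ω) :=
    hinv.mono frontier_subset_closure frontier_subset_closure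
  have hΘf : BijOn Θ (frontier Ω) (frontier Ω) := hΦf.symm hinvf.symm
  have hΨf := h₁.bijOn_frontier hΩ.isOpen
  have hΨi := h₁.bijOn_inverse_frontier hΩ.isOpen
  have hΨinv : InvOn (modelInverse P₁ Ψ₁) Ψ₁ (frontier P₁) (frontier Ω) :=
    h₁.invOn.mono frontier_subset_closure frontier_subset_closure
  have hVΩ := h₁.vertices_subset
  have hVP := polytopeVertices_subset_frontier P₁
  have hinvV : ∀ w ∈ polytopeVertices P₁, modelInverse P₁ Ψ₁ w = w := fun w hw => by
    have := hΨinv.1 (hVP hw)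
    rwa [h₁.eq_on_vertices w hw] at this
  -- the vertices of `P₂` in a set which joins `v` to its preimage
  have hV2 : ∀ T : Set Plane, v ∈ T →
      (∀ v ∈ polytopeVertices P₁, ∀ w ∈ polytopeVertices P₁, v ∈ T → w ∈ T → v = w) →
      (∀ v ∈ fictitiousVertices Ω P₁, ∀ w ∈ fictitiousVertices Ω P₂, v ∈ T → w ∉ T) →
      Disjoint T (polytopeVertices P₂) := by
    intro T hvT h3 h4
    refine disjoint_left.2 fun u huT hu => ?_
    by_cases hang : u ∈ angularPoints Ω
    · have := h3 v hv.1 u (h₁.angular_subset hang) hvT huT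
      exact hv.2 (this ▸ hang)
    · exact h4 v hv u ⟨hu, hang⟩ hvT huT
  -- the transported map of the boundary of `P₁`
  let g : Plane → Plane := fun x => modelInverse P₁ Ψ₁ (Φ (Ψ₁ x))
  have hgb : BijOn g (frontier P₁) (frontier P₁) := hΨi.comp (hΦf.comp hΨf)
  have hgc : ContinuousOn g (frontier P₁) :=
    (h₁.continuousOn_inverse.mono frontier_subset_closure).comp
      ((hΦ.contDiffOn.continuousOn.mono frontier_subset_closure).comp
        (h₁.continuousOn.mono frontier_subset_closure) hΨf.mapsTo)
      (hΦf.mapsTo.comp hΨf.mapsTo)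
  have hT' : ∀ x ∈ frontier P₁, ∃ T, IsPreconnected T ∧ T ⊆ frontier P₁ ∧ x ∈ T ∧ g x ∈ T ∧
      (∀ v ∈ polytopeVertices P₁, ∀ w ∈ polytopeVertices P₁, v ∈ T → w ∈ T → v = w) ∧
      (v ∈ T → ∀ z ∈ T, Ψ₁ z ∉ polytopeVertices P₂) := by
    intro x hx
    obtain ⟨T, hTc, hTF, h1, h2, h3, h4⟩ :=
      exists_isPreconnected_of_deformationBound hC (hΨf.mapsTo hx)
    have hback : ∀ z ∈ modelInverse P₁ Ψ₁ '' T, Ψ₁ z ∈ T := by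
      rintro _ ⟨y, hy, rfl⟩
      rwa [hΨinv.2 (hTF hy)]
    have hbackV : ∀ w ∈ polytopeVertices P₁, w ∈ modelInverse P₁ Ψ₁ '' T → w ∈ T :=
      fun w hw hwT => by
        have := hback w hwT
        rwa [h₁.eq_on_vertices w hw] at this
    refine ⟨modelInverse P₁ Ψ₁ '' T, hTc.image _ (h₁.continuousOn_inverse.mono
      (hTF.trans frontier_subset_closure)), (hΨi.mapsTo.mono_left hTF).image_subset,
      ⟨_, h1, hΨinv.1 hx⟩, ⟨_, h2, rfl⟩, fun a ha b hb haT hbT => ?_, fun hvT z hz => ?_⟩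
    · exact h3 a ha b hb (hbackV a ha haT) (hbackV b hb hbT)
    · exact disjoint_left.1 (hV2 T (hbackV v hv.1 hvT) h3 h4) (hback z hz)
  let q : Plane → Plane := fun w => modelInverse P₁ Ψ₁ (Θ w)
  have hqF : ∀ w ∈ polytopeVertices P₁, q w ∈ frontier P₁ := fun w hw =>
    hΨi.mapsTo (hΘf.mapsTo (hVΩ hw))
  have hΨq : ∀ w ∈ polytopeVertices P₁, Ψ₁ (q w) = Θ w := fun w hw =>
    hΨinv.2 (hΘf.mapsTo (hVΩ hw))
  have hgq : ∀ w ∈ polytopeVertices P₁, g (q w) = w := fun w hw => by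
    simp only [g, hΨq w hw, hinvf.2 (hVΩ hw), hinvV w hw]
  have hqinj : ∀ w ∈ polytopeVertices P₁, q w = q v → w = v := fun w hw e => by
    rw [← hgq w hw, e, hgq v hv.1]
  have hqV : ∀ w ∈ polytopeVertices P₁, q w ∈ polytopeVertices P₁ → q w = w := by
    intro w hw hqw
    obtain ⟨T, -, -, h1, h2, h3, -⟩ := hT' (q w) (hqF w hw)
    rw [hgq w hw] at h2
    exact h3 _ hqw _ hw h1 h2
  -- it is enough to find a connected set in the boundary of `P₁`
  suffices ∃ K : Set Plane, IsPreconnected K ∧ K ⊆ frontier P₁ ∧ q v ∈ K ∧ v ∈ K ∧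
      (∀ z ∈ K, Ψ₁ z ∉ polytopeVertices P₂) ∧
      ∀ w ∈ polytopeVertices P₁, w ≠ v → w ∉ K ∧ q w ∉ K by
    obtain ⟨K, hKc, hKF, k1, k2, k3, k4⟩ := this
    have hmem : ∀ z ∈ frontier P₁, Ψ₁ z ∈ Ψ₁ '' K → z ∈ K := by
      rintro z hz ⟨y, hy, hyz⟩
      rwa [← hΨf.injOn (hKF hy) hz hyz]
    refine ⟨Ψ₁ '' K, hKc.image _ (h₁.continuousOn.mono (hKF.trans frontier_subset_closure)),
      (hΨf.mapsTo.mono_left hKF).image_subset, ⟨_, k1, hΨq v hv.1⟩,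
      ⟨_, k2, h₁.eq_on_vertices v hv.1⟩, ?_, fun w hw hwv => ⟨fun hc => ?_, fun hc => ?_⟩⟩
    · refine disjoint_left.2 ?_
      rintro _ ⟨z, hz, rfl⟩
      exact k3 z hz
    · rw [← h₁.eq_on_vertices w hw] at hc
      exact (k4 w hw hwv).1 (hmem w (hVP hw) hc)
    · rw [← hΨq w hw] at hc
      exact (k4 w hw hwv).2 (hmem _ (hqF w hw) hc)
  obtain ⟨T, hTc, hTF, t1, t2, t3, t4⟩ := hT' (q v) (hqF v hv.1)
  rw [hgq v hv.1] at t2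
  by_cases hqv : q v ∈ polytopeVertices P₁
  · have hqv' := hqV v hv.1 hqv
    refine ⟨{v}, isPreconnected_singleton, by simpa using hVP hv.1, by simpa using hqv', rfl,
      ?_, fun w hw hwv => ⟨by simpa using hwv, ?_⟩⟩
    · rintro z rfl
      exact t4 t2 z t2
    · intro hc
      rw [mem_singleton_iff] at hc
      exact hwv (hqinj w hw (hc.trans hqv'.symm))
  obtain ⟨b, he, hqe⟩ : ∃ b, IsPolytopeEdge P₁ v b ∧ q v ∈ openSegment ℝ v b := by
    obtain ⟨a, b, he, hqe⟩ := h₁.exists_edge hΩ (hqF v hv.1) hqv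
    rcases he.endpoint_mem_of_isPreconnected hTc hTF t1 hqe t2
      (fun hc => (he.subset hc).2 hv.1) with hm | hm
    · obtain rfl := t3 _ hv.1 _ he.left_mem t2 hm
      exact ⟨b, he, hqe⟩
    · obtain rfl := t3 _ hv.1 _ he.right_mem t2 hm
      exact ⟨a, he.symm, by rwa [openSegment_symm]⟩
  rw [openSegment_eq_image_lineMap] at hqe
  obtain ⟨t, ht, hqt⟩ := hqe
  have hopen : ∀ r ∈ Ioc 0 t, AffineMap.lineMap v b r ∈ openSegment ℝ v b := fun r hr => by
    rw [openSegment_eq_image_lineMap]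
    exact mem_image_of_mem _ ⟨hr.1, hr.2.trans_lt ht.2⟩
  have hnotV : ∀ r ∈ Icc 0 t, AffineMap.lineMap v b r ∈ polytopeVertices P₁ →
      (AffineMap.lineMap v b r : Plane) = v := by
    intro r hr hrV
    rcases hr.1.eq_or_lt with rfl | h0
    · simp
    · exact absurd hrV (he.subset (hopen r ⟨h0, hr.2⟩)).2
  refine ⟨AffineMap.lineMap v b '' Icc (0 : ℝ) t,
    isPreconnected_Icc.image _ AffineMap.lineMap_continuous.continuousOn, ?_,
    ⟨t, right_mem_Icc.2 ht.1.le, hqt⟩, ⟨0, left_mem_Icc.2 ht.1.le, by simp⟩, ?_,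
    fun w hw hwv => ⟨?_, ?_⟩⟩
  · refine Subset.trans ?_ he.segment_subset
    rw [segment_eq_image_lineMap]
    exact image_mono (Icc_subset_Icc_right ht.2.le)
  · rintro _ ⟨r, hr, rfl⟩
    -- T contains v and the preimage but not b, so it contains the whole segment between v and the
    -- preimage, and inherits to it the absence of vertices of P₂.
    refine t4 t2 _ (he.mem_of_isPreconnected hTc hTF t2 (fun hb => ?_) hr.1 hr.2 ht.2
      (by rw [hqt]; exact t1))
    exact he.ne (t3 _ hv.1 _ he.right_mem t2 hb)
  · rintro ⟨r, hr, rfl⟩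
    exact hwv (hnotV r hr hw)
  · rintro ⟨r, hr, hrw⟩
    have hvw : q w ≠ v := fun e => hwv ((hqV w hw (e ▸ hv.1)).symm.trans e)
    have hr0 : 0 < r := lt_of_le_of_ne hr.1 fun h0 => hvw (by rw [← hrw, ← h0]; simp)
    have hrt : r < t := lt_of_le_of_ne hr.2 fun h0 => hwv (hqinj w hw (by rw [← hrw, h0, hqt]))
    obtain ⟨T', hTc', hTF', s1, s2, s3, -⟩ := hT' (q w) (hqF w hw)
    rw [hgq w hw] at s2
    -- The set joining the preimage of w to w leaves the open edge through v or b and contains no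
    -- vertex but w; this leaves only b, and the order of the preimages is reversed.
    have hwb : w = b := by
      rcases he.endpoint_mem_of_isPreconnected hTc' hTF' s1 (hrw ▸ hopen r ⟨hr0, hr.2⟩) s2
        (fun hc => (he.subset hc).2 hw) with hm | hm
      · exact absurd (s3 _ hw _ hv.1 s2 hm) hwv
      · exact s3 _ hw _ he.right_mem s2 hm
    refine h₁.not_crossing hΩ hgc hgb.injOn hgb.mapsTo (fun x hx => ?_) he hr0 hrt ht.2 ?_ ?_
    · obtain ⟨T'', a1, a2, a3, a4, a5, -⟩ := hT' x hx
      exact ⟨T'', a1, a2, a3, a4, a5⟩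
    · rw [hrw, hgq w hw, hwb]
    · rw [hqt, hgq v hv.1]

/-- A bi-Lipschitz map which preserves the domain, fixes the vertices of `P₂`, and moves the
preimages of the vertices of `P₁` to these vertices. -/
theorem exists_fixingMaps_vertices (hΩ : IsLipschitzDomain Ω)
    (h₁ : IsPolytopalModel Ω P₁ Ψ₁) (h₂ : IsPolytopalModel Ω P₂ Ψ₂)
    (hΦ : IsDomainDiffeo Ω Φ) (hinv : InvOn Θ Φ (closure Ω) (closure Ω))
    (hC : ∀ x ∈ frontier Ω, boundaryDist Ω x (Φ x) < deformationBound Ω P₁ P₂) :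
    ∃ B ∈ fixingMaps Ω (polytopeVertices P₂), ∀ v ∈ polytopeVertices P₁, B (Θ v) = v := by
  classical
  have hfin₁ := h₁.regular.1.finite_polytopeVertices
  have hfin₂ := h₂.regular.1.finite_polytopeVertices
  have hind : ∀ s : Finset Plane, (∀ v ∈ s, v ∈ fictitiousVertices Ω P₁) →
      ∃ B ∈ fixingMaps Ω (polytopeVertices P₂), (∀ v ∈ s, B (Θ v) = v) ∧
        ∀ v ∈ polytopeVertices P₁, v ∉ s → B (Θ v) = Θ v := by
    intro s
    induction s using Finset.induction_on with
    | empty => exact fun _ => ⟨_, refl_mem_fixingMaps _ _, by simp, fun _ _ _ => rfl⟩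
    | insert v s hvs ih =>
      intro hs
      obtain ⟨B, hB, hB1, hB2⟩ := ih fun w hw => hs w (Finset.mem_insert_of_mem hw)
      have hv := hs v (Finset.mem_insert_self v s)
      obtain ⟨K, hKc, hKF, k1, k2, k3, k4⟩ :=
        exists_isPreconnected_to_vertex hΩ h₁ hΦ hinv hC hv
      let W := polytopeVertices P₁ \ {v}
      have hfinW : W.Finite := hfin₁.subset sdiff_subset
      -- Fixing W protects the vertices already reached; fixing the preimages of W keeps those still
      -- to be moved in place.
      obtain ⟨B', hB', hB'v⟩ := hΩ.exists_fixingMaps (F := polytopeVertices P₂ ∪ (W ∪ Θ '' W))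
        (hfin₂.union (hfinW.union (hfinW.image Θ))).isClosed hKc hKF (by
          refine disjoint_union_right.2 ⟨k3, disjoint_union_right.2 ⟨?_, ?_⟩⟩
          · exact disjoint_right.2 fun w hw => (k4 w hw.1 hw.2).1
          · refine disjoint_right.2 ?_
            rintro _ ⟨w, hw, rfl⟩
            exact (k4 w hw.1 hw.2).2) k1 k2
      refine ⟨B.trans B', trans_mem_fixingMaps hB
        (fixingMaps_anti subset_union_left hB'), ?_, ?_⟩
      · intro w hw
        rcases Finset.mem_insert.1 hw with rfl | hws
        · rw [Equiv.trans_apply, hB2 w hv.1 hvs, hB'v]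
        · rw [Equiv.trans_apply, hB1 w hws]
          exact hB'.2.2.2 w (Or.inr (Or.inl ⟨(hs w hw).1, fun e => hvs (e ▸ hws)⟩))
      · intro w hw hws
        rw [Finset.mem_insert, not_or] at hws
        rw [Equiv.trans_apply, hB2 w hw hws.2]
        exact hB'.2.2.2 _ (Or.inr (Or.inr ⟨w, ⟨hw, hws.1⟩, rfl⟩))
  have hfinF : (fictitiousVertices Ω P₁).Finite := hfin₁.subset sdiff_subset
  obtain ⟨B, hB, hB1, hB2⟩ := hind hfinF.toFinset fun v hv => hfinF.mem_toFinset.1 hv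
  refine ⟨B, hB, fun v hv => ?_⟩
  by_cases hang : v ∈ angularPoints Ω
  · rw [hB2 v hv fun hc => (hfinF.mem_toFinset.1 hc).2 hang,
      apply_angular_eq hΩ h₁ hΦ hinv hC hang]
  · exact hB1 v (hfinF.mem_toFinset.2 ⟨hv, hang⟩)

end vertices

theorem bijOn_of_mem_fixingMaps {Ω F : Set Plane} {B : Plane ≃ Plane} (hB : B ∈ fixingMaps Ω F) :
    BijOn B Ω Ω ∧ BijOn B (closure Ω) (closure Ω) := by
  obtain ⟨⟨K, hK⟩, ⟨L, hL⟩, h3, -⟩ := hB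
  have himg : B '' Ω = Ω := by
    ext y
    constructor
    · rintro ⟨x, hx, rfl⟩; exact (h3 x).2 hx
    · intro hy
      exact ⟨B.symm y, (h3 _).1 (by rwa [B.apply_symm_apply]), B.apply_symm_apply y⟩
  let H : Plane ≃ₜ Plane := ⟨B, hK.continuous, hL.continuous⟩
  have himg' : B '' closure Ω = closure Ω := by
    have := H.image_closure Ω
    change B '' closure Ω = closure (B '' Ω) at this
    rw [this, himg]
  exact ⟨⟨fun x hx => (h3 x).2 hx, B.injective.injOn, himg.ge⟩,
    ⟨fun x hx => himg'.le (mem_image_of_mem _ hx), B.injective.injOn, himg'.ge⟩⟩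

theorem mainTheorem2 (Ω : Set Plane) (hΩ : IsLipschitzDomain Ω)
    (P₁ P₂ : Set Plane) (Ψ₁ Ψ₂ : Plane → Plane)
    (h₁ : IsPolytopalModel Ω P₁ Ψ₁) (h₂ : IsPolytopalModel Ω P₂ Ψ₂)
    (Φ : Plane → Plane) (hΦ : IsDomainDiffeo Ω Φ)
    (hJ : ∀ x ∈ Ω, 0 < (fderiv ℝ Φ x).det)
    (hC : ∀ x ∈ frontier Ω, boundaryDist Ω x (Φ x) < deformationBound Ω P₁ P₂) :
    ∃ Φ₁ Φ₂ φ₁ φ₂ : Plane → Plane,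
      (∀ x, Φ₁ x = x + φ₁ x) ∧ (∀ x, Φ₂ x = x + φ₂ x) ∧
      IsTangentialDisplacement P₁ φ₁ ∧ IsTangentialDisplacement P₂ φ₂ ∧
      (∀ x ∈ closure Ω,
        Φ x = (Ψ₁ ∘ Φ₁ ∘ modelInverse P₁ Ψ₁ ∘ Ψ₂ ∘ Φ₂ ∘ modelInverse P₂ Ψ₂) x) ∧
      ((∃ K : ℝ≥0, LipschitzOnWith K (modelInverse P₁ Ψ₁) (closure Ω)) →
        ∃ K : ℝ≥0, LipschitzOnWith K φ₁ (closure P₁)) ∧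
      ((∃ K : ℝ≥0, LipschitzOnWith K (modelInverse P₂ Ψ₂) (closure Ω)) →
        ∃ K : ℝ≥0, LipschitzOnWith K φ₂ (closure P₂)) := by
  obtain ⟨Θ, -, hinv⟩ := hΦ.contDiffOn_inverse
  obtain ⟨B, hB, hBV⟩ := exists_fixingMaps_vertices hΩ h₁ h₂ hΦ hinv hC
  have hB' := symm_mem_fixingMaps hB
  obtain ⟨b1, b2⟩ := bijOn_of_mem_fixingMaps hB
  obtain ⟨b1', b2'⟩ := bijOn_of_mem_fixingMaps hB'
  obtain ⟨L, hL⟩ := hΩ.exists_lipschitzOnWith h₁.isCompact_closure_domain hΦ.contDiffOn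
  obtain ⟨⟨K, hK⟩, ⟨K', hK'⟩, -, hBfix⟩ := hB
  have hAlip : LipschitzOnWith (L * K') (Φ ∘ B.symm) (closure Ω) :=
    hL.comp hK'.lipschitzOnWith b2'.mapsTo
  have hA : BijOn (Φ ∘ B.symm) (closure Ω) (closure Ω) := hΦ.bijOn_closure.comp b2'
  have hAV : ∀ v ∈ polytopeVertices P₁, (Φ ∘ B.symm) v = v := by
    intro v hv
    have : B.symm v = Θ v := by rw [B.symm_apply_eq, hBV v hv]
    rw [Function.comp_apply, this, hinv.2 (frontier_subset_closure (h₁.vertices_subset hv))]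
  -- Φ₁ and Φ₂ are the conjugates of Φ ∘ B⁻¹ and of B.
  refine ⟨fun x => x + (modelInverse P₁ Ψ₁ ((Φ ∘ B.symm) (Ψ₁ x)) - x),
    fun x => x + (modelInverse P₂ Ψ₂ (B (Ψ₂ x)) - x), _, _, fun x => rfl, fun x => rfl,
    h₁.isTangentialDisplacement hΩ hAlip.continuousOn (hΦ.bijOn.comp b1') hA hAV,
    h₂.isTangentialDisplacement hΩ hK.continuous.continuousOn b1 b2 hBfix, fun x hx => ?_,
    h₁.exists_lipschitzOnWith_displacement ⟨_, hAlip⟩ hA.mapsTo,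
    h₂.exists_lipschitzOnWith_displacement ⟨_, hK.lipschitzOnWith⟩ b2.mapsTo⟩
  simp only [Function.comp_apply, add_sub_cancel]
  rw [h₂.invOn.2 hx, h₂.invOn.2 (b2.mapsTo hx), h₁.invOn.2 (b2.mapsTo hx), B.symm_apply_apply,
    h₁.invOn.2 (hΦ.bijOn_closure.mapsTo hx)]
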